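/- Let $p\ge 1$, $q\ge 0$ be integers. $\operatorname{Deco}(p,q)$ is the set of strings of $p$ plus signs and $q$ minus signs. A signature $[\delta\delta']$ with $\delta\in\operatorname{Deco}(p,q)$, $\delta'\in\operatorname{Deco}(p-1,q)$ is a string in the symbols $+,-,\oplus,\ominus$ whose substring of uncircled symbols is $\delta$ and whose substring of circled symbols, read as signs, is $\delta'$. It is a GGP interleaving pattern if every pair of adjacent symbols is one of $\oplus+$, $+\oplus$, $-\ominus$, $\ominus-$, $+-$, $-+$, $\oplus\ominus$, $\ominus\oplus$. Write $+_i$ for the $i$-th $+$ from the left, similarly for the other symbols, and $x>y$ if $x$ stands to the left of $y$. *Parameters.* Put $K=U(p)\times U(q)$ and $K'=U(p-1)\times U(q)$, embedded in $K$ by $U(p-1)\ni g\mapsto\operatorname{diag}(g,1)\in U(p)$. Put $\Phi^{+}=\{e_i-e_j: 1\le i<j\le p+q\}$, let $\Phi^{c,+}$ be the subset where $i,j\le p$ or $i,j>p$, and let $\rho_{\mathfrak g}$, $\rho_c$ be half the sums of $\Phi^+$, $\Phi^{c,+}$. A Harish-Chandra parameter of $U(p,q)$ is an element $\lambda$ of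 $(\mathbb Z+\frac{p+q+1}{2})^{p+q}$ with pairwise distinct coordinates, $\lambda_1>\dots>\lambda_p$ and $\lambda_{p+1}>\dots>\lambda_{p+q}$; let $\rho(\lambda)$ be half the sum of the roots $e_i-e_j$ with $\lambda_i>\lambda_j$. Let $F^K(\nu)$ be the irreducible finite-dimensional continuous complex representation of $K$ with highest weight $\nu$ (with respect to $\Phi^{c,+}$), and put $$\mu_\lambda=\lambda+\rho(\lambda)-2\rho_c,\qquad W_\lambda=F^K(\lambda-\rho_{\mathfrak g}).$$ Use the same notions for $U(p-1,q)$ and $K'$, with coordinates indexed by $1,\dots,p-1,p+1,\dots,p+q$, to define $\lambda'$, $\mu'_{\lambda'}$, $W'_{\lambda'}$. The signature associated with $(\lambda,\lambda')$ is obtained by arranging all coordinates of $\lambda$ and $\lambda'$ in descending order (no two are equal) and replacing $\lambda_i$ by $+$ if $i\le p$ and by $-$ if $i>p$, and $\lambda'_i$ by $\oplus$ if $i<p$ and by $\ominus$ if $i>p$. *Conditions* on a GGP interleaving pattern $[\delta\delta']$ with $\delta\in\operatorname{Deco}(p,q)$, $\delta'\in\operatorname{Deco}(p-1,q)$: * $(q)$: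 $q(\delta)=q(\delta')$, where $q(\delta)$ is the number of pairs $(+,-)$ in $\delta$ with $+$ to the left of $-$. * $(\delta+)$: $\delta$ is obtained from $\delta'$ by adding a $+$ at the right end (reading $\oplus$ as $+$ and $\ominus$ as $-$). * $(nc)$: $\Phi^{nc,+}(\delta)=\Phi^{nc,+}(\delta')$, where $\Phi^{nc,+}(\delta)$ is the set of roots $e_i-e_{p+j}$ such that the $i$-th $+$ stands to the left of the $j$-th $-$ in $\delta$, and $\Phi^{nc,+}(\delta')$ is defined by the same rule from $\delta'$. * $(\mu)$: $[\delta\delta']$ is the signature associated with some pair $(\lambda,\lambda')$ of Harish-Chandra parameters of $U(p,q)$ and $U(p-1,q)$ such that $\operatorname{Hom}_{K'}(F^K(\mu_\lambda)|_{K'},F^{K'}(\mu'_{\lambda'}))\ne 0$. * $(W)$: $[\delta\delta']$ is the signature associated with some such pair $(\lambda,\lambda')$ with $\operatorname{Hom}_{K'}(W_\lambda|_{K'},W'_{\lambda'})\ne 0$. * $(-\ominus-)$: $+_i>\oplus_i>+_{i+1}$ for $1\le i\le p-1$, and $-_{j-1}>\ominus_j>-_j$ for $1\le j\le q$, where for $j=1$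 only $\ominus_1>-_1$ is required. **Proposition.** Let $[\delta\delta']$ be a GGP interleaving pattern with $\delta\in\operatorname{Deco}(p,q)$ and $\delta'\in\operatorname{Deco}(p-1,q)$. (1) The following six conditions are equivalent: (i) $(W)$ holds; (ii) $[\delta\delta']$ can be reduced to the single symbol $+$ by successively deleting pairs $+\oplus$ or $\ominus-$ from the left end or pairs $\oplus+$ from the right end; (iii) $[\delta\delta']$ can be reduced to the single symbol $+$ by successively deleting pairs $+\oplus$ or $\ominus-$ from the left end; (iv) $(-\ominus-)$ holds; (v) $(-\ominus-)$ holds and the rightmost symbol of $[\delta\delta']$ is $+$; (vi) $(nc)$ and $(\mu)$ hold. (2) If these equivalent conditions hold, then $(\mu)$, $(q)$ and $(\delta+)$ hold. -/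

import Mathlib

namespace UnitaryGGP

/-! ### Decorations and signatures -/

/-- The two signs occurring in a decoration. -/
inductive Sign : Type
  | plus
  | minus
  deriving DecidableEq

/-- The four symbols `+`, `-`, `⊕`, `⊖` occurring in a signature `[δδ']`. -/
inductive Symbol : Type
  | plus
  | minus
  | oplus
  | ominus
  deriving DecidableEq

/-- `δ ∈ Deco(p,q)`: a string of `p` plus signs and `q` minus signs, in any order. -/
def IsDecoration (p q : ℕ) (δ : List Sign) : Prop :=
  δ.count Sign.plus = p ∧ δ.count Sign.minus = q

/-- The sign carried by an uncircled symbol. -/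
def Symbol.uncircled : Symbol → Option Sign
  | .plus => some .plus
  | .minus => some .minus
  | .oplus => none
  | .ominus => none

/-- The sign carried by a circled symbol. -/
def Symbol.circled : Symbol → Option Sign
  | .plus => none
  | .minus => none
  | .oplus => some .plus
  | .ominus => some .minus

/-- The decoration `δ` of a signature `s = [δδ']`: the substring of the symbols `+`, `-`. -/
def deco (s : List Symbol) : List Sign := s.filterMap Symbol.uncircled

/-- The decoration `δ'` of a signature `s = [δδ']`: the substring of the symbols `⊕`, `⊖`,
with `⊕` read as `+` and `⊖` read as `-`. -/
def deco' (s : List Symbol) : List Sign := s.filterMap Symbol.circled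

/-- `s = [δδ']` with `δ ∈ Deco(m+1,q)` and `δ' ∈ Deco(m,q)`; thus `p = m + 1`. -/
def IsSignature (m q : ℕ) (s : List Symbol) : Prop :=
  IsDecoration (m + 1) q (deco s) ∧ IsDecoration m q (deco' s)

/-- The adjacent pairs allowed in a GGP interleaving pattern. -/
inductive GGPAdjacent : Symbol → Symbol → Prop
  | oplus_plus : GGPAdjacent .oplus .plus
  | plus_oplus : GGPAdjacent .plus .oplus
  | minus_ominus : GGPAdjacent .minus .ominus
  | ominus_minus : GGPAdjacent .ominus .minus
  | plus_minus : GGPAdjacent .plus .minus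
  | minus_plus : GGPAdjacent .minus .plus
  | oplus_ominus : GGPAdjacent .oplus .ominus
  | ominus_oplus : GGPAdjacent .ominus .oplus

/-- All adjacent pairs of symbols of `s` are in the list of allowed pairs. -/
def IsGGPPattern (s : List Symbol) : Prop := s.IsChain GGPAdjacent

/-- The occurrence number `i` (counted from `0`) of the letter `x` in the string `s` stands
strictly to the left of the occurrence number `j` (counted from `0`) of the letter `y`. In
particular both occurrences exist. -/
def Precedes {α : Type} [DecidableEq α] (s : List α) (x : α) (i : ℕ) (y : α) (j : ℕ) : Prop :=
  ∃ k l : ℕ, k < l ∧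
    (s[k]? = some x ∧ (s.take k).count x = i) ∧
    (s[l]? = some y ∧ (s.take l).count y = j)

/-- The degree `q(δ)`: the number of pairs of positions in `δ` occupied by a `+` and by a `-`
to the right of it. -/
def degree (δ : List Sign) : ℕ :=
  ((Finset.range δ.length ×ˢ Finset.range δ.length).filter fun x =>
    x.1 < x.2 ∧ δ[x.1]? = some Sign.plus ∧ δ[x.2]? = some Sign.minus).card

/-- The set `Φ^{nc,+}(δ)` of the roots `e_i - e_{p+j}` such that the `i`-th `+` of `δ` stands to
the left of its `j`-th `-`. This root is recorded as the pair of the index of the `+` and the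
index of the `-`, both counted from `0`. The roots of the subgroup `U(p-1,q)` are among those of
`U(p,q)` as the roots in which the index `p` does not occur, so they have the same labels. -/
def ncRoots (δ : List Sign) : Set (ℕ × ℕ) :=
  {x | Precedes δ Sign.plus x.1 Sign.minus x.2}

/-! ### Conditions on a signature that involve no representation -/

/-- Condition `(q)`. -/
def CondQ (s : List Symbol) : Prop := degree (deco s) = degree (deco' s)

/-- Condition `(δ+)`. -/
def CondDeltaPlus (s : List Symbol) : Prop := deco s = deco' s ++ [Sign.plus]

/-- Condition `(nc)`. -/
def CondNC (s : List Symbol) : Prop := ncRoots (deco s) = ncRoots (deco' s)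

/-- Condition `(-⊖-)`, for `p = m + 1`: one has `+_i > ⊕_i > +_{i+1}` for `1 ≤ i ≤ p - 1`, and
`-_{j-1} > ⊖_j > -_j` for `1 ≤ j ≤ q`, where `-_{j-1}` is disregarded if `j = 1`. (Occurrences
are counted from `0` below.) -/
def CondMinusOminusMinus (m q : ℕ) (s : List Symbol) : Prop :=
  (∀ i < m, Precedes s .plus i .oplus i ∧ Precedes s .oplus i .plus (i + 1)) ∧
  (∀ j < q, Precedes s .ominus j .minus j) ∧
  (∀ j, j + 1 < q → Precedes s .minus j .ominus (j + 1))

/-- One step of the weaker reduction: delete `+⊕` or `⊖-` from the left. -/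
inductive WeakStep : List Symbol → List Symbol → Prop
  | plus_oplus (s : List Symbol) : WeakStep (.plus :: .oplus :: s) s
  | ominus_minus (s : List Symbol) : WeakStep (.ominus :: .minus :: s) s

/-- One step of the reduction: delete `+⊕` or `⊖-` from the left, or `⊕+` from the right. -/
inductive Step : List Symbol → List Symbol → Prop
  | plus_oplus (s : List Symbol) : Step (.plus :: .oplus :: s) s
  | ominus_minus (s : List Symbol) : Step (.ominus :: .minus :: s) s
  | oplus_plus (s : List Symbol) : Step (s ++ [.oplus, .plus]) s

/-! ### Roots and parameters of discrete series -/

/-- The coordinates `1, …, p+q` of the torus of `U(p,q)`: the first `p` and the last `q`. -/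
abbrev Idx (p q : ℕ) : Type := Fin p ⊕ Fin q

/-- `PosRoot a b`: the root `e_a - e_b` is in `Φ⁺`. -/
def PosRoot {p q : ℕ} : Idx p q → Idx p q → Prop
  | .inl i, .inl j => i < j
  | .inl _, .inr _ => True
  | .inr _, .inl _ => False
  | .inr i, .inr j => i < j

/-- `CompactPosRoot a b`: the root `e_a - e_b` is in `Φ^{c,+}`. -/
def CompactPosRoot {p q : ℕ} : Idx p q → Idx p q → Prop
  | .inl i, .inl j => i < j
  | .inl _, .inr _ => False
  | .inr _, .inl _ => False
  | .inr i, .inr j => i < j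

/-- Half the sum of the roots `e_a - e_b` with `R a b`. -/
noncomputable def halfSum {p q : ℕ} (R : Idx p q → Idx p q → Prop) : Idx p q → ℝ :=
  open Classical in
  (1 / 2 : ℝ) • ∑ a, ∑ b,
    if R a b then (Pi.single a 1 - Pi.single b 1 : Idx p q → ℝ) else 0

/-- `ρ_𝔤`. -/
noncomputable def rhoG (p q : ℕ) : Idx p q → ℝ := halfSum PosRoot

/-- `ρ_c`. -/
noncomputable def rhoC (p q : ℕ) : Idx p q → ℝ := halfSum CompactPosRoot

/-- `ρ(δ) = w ρ_𝔤` for the decoration `δ` of the regular element `lam = w lam⁺`: half the sum of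
the set `w Φ⁺` of the roots that are positive on `lam`. -/
noncomputable def rhoOf {p q : ℕ} (lam : Idx p q → ℝ) : Idx p q → ℝ :=
  halfSum fun a b => lam b < lam a

/-- The Harish-Chandra parameters of discrete series of `U(p,q)`: the regular elements of
`(ℤ + (p+q+1)/2)^{p+q}` that are strictly dominant for `Φ^{c,+}`. -/
def IsHCParam {p q : ℕ} (lam : Idx p q → ℝ) : Prop :=
  (∀ a, ∃ k : ℤ, lam a = k + ((p : ℝ) + q + 1) / 2) ∧
  Function.Injective lam ∧
  StrictAnti (fun i => lam (Sum.inl i)) ∧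
  StrictAnti (fun j => lam (Sum.inr j))

/-- The Blattner parameter `μ_λ = λ + ρ(δ) - 2ρ_c`. -/
noncomputable def blattner {p q : ℕ} (lam : Idx p q → ℝ) : Idx p q → ℝ :=
  lam + rhoOf lam - (2 : ℝ) • rhoC p q

/-- The coherent parameter `Λ = λ - ρ_𝔤`. -/
noncomputable def coherentParam {p q : ℕ} (lam : Idx p q → ℝ) : Idx p q → ℝ :=
  lam - rhoG p q

/-- The symbol attached to a coordinate of `λ` or of `λ'`. -/
def symbolOf {m q : ℕ} : Idx (m + 1) q ⊕ Idx m q → Symbol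
  | .inl (.inl _) => .plus
  | .inl (.inr _) => .minus
  | .inr (.inl _) => .oplus
  | .inr (.inr _) => .ominus

/-- `s` is the signature associated with `(λ, λ')`: all coordinates of `λ` and `λ'` are put in
(strictly) descending order and are then replaced by their symbols. -/
def IsAssociatedSignature {m q : ℕ} (lam : Idx (m + 1) q → ℝ) (lam' : Idx m q → ℝ)
    (s : List Symbol) : Prop :=
  ∃ l : List (Idx (m + 1) q ⊕ Idx m q),
    (∀ a, a ∈ l) ∧
    l.Pairwise (fun a b => Sum.elim lam lam' b < Sum.elim lam lam' a) ∧
    l.map symbolOf = s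

/-! ### Representations of `K = U(p) × U(q)` and branching to `K' = U(p-1) × U(q)` -/

/-- The compact group `K = U(p) × U(q)`. -/
abbrev KGroup (p q : ℕ) : Type :=
  Matrix.unitaryGroup (Fin p) ℂ × Matrix.unitaryGroup (Fin q) ℂ

/-- The embedding `U(m) → U(m+1)`, `g ↦ diag(g, 1)`: its image is the group of the unitary matrices
that fix the last basis vector. -/
def inclU (m : ℕ) : Matrix.unitaryGroup (Fin m) ℂ →* Matrix.unitaryGroup (Fin (m + 1)) ℂ where
  toFun g := ⟨Matrix.reindex finSumFinEquiv finSumFinEquiv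
      (Matrix.fromBlocks (g : Matrix (Fin m) (Fin m) ℂ) 0 0 (1 : Matrix (Fin 1) (Fin 1) ℂ)), by
    have h := Matrix.mem_unitaryGroup_iff.mp g.2
    rw [Matrix.star_eq_conjTranspose] at h
    rw [Matrix.mem_unitaryGroup_iff, Matrix.star_eq_conjTranspose, Matrix.conjTranspose_reindex,
      Matrix.reindex_apply, Matrix.reindex_apply, Matrix.submatrix_mul_equiv,
      Matrix.fromBlocks_conjTranspose, Matrix.fromBlocks_multiply]
    simp [h]⟩
  map_one' := by
    apply Subtype.ext
    simp
  map_mul' g h := by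
    apply Subtype.ext
    simp only [Matrix.reindex_apply, Submonoid.coe_mul, Matrix.submatrix_mul_equiv,
      Matrix.fromBlocks_multiply]
    simp

/-- The embedding `K' = U(m) × U(q) → K = U(m+1) × U(q)`. -/
def inclK (m q : ℕ) : KGroup m q →* KGroup (m + 1) q :=
  (inclU m).prodMap (MonoidHom.id _)

/-- The integral weight `ν` occurs in the representation `σ` of `K`: there is a nonzero vector on
which every `t` in the diagonal torus acts by the scalar `∏ t_a ^ ν_a`. -/
def IsWeight {p q : ℕ} {V : Type} [AddCommGroup V] [Module ℂ V]
    (σ : Representation ℂ (KGroup p q) V) (ν : Idx p q → ℤ) : Prop :=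
  ∃ v : V, v ≠ 0 ∧ ∀ t : KGroup p q,
    (t.1 : Matrix (Fin p) (Fin p) ℂ).IsDiag → (t.2 : Matrix (Fin q) (Fin q) ℂ).IsDiag →
    σ t v = ((∏ i, (t.1 : Matrix (Fin p) (Fin p) ℂ) i i ^ ν (Sum.inl i)) *
      ∏ j, (t.2 : Matrix (Fin q) (Fin q) ℂ) j j ^ ν (Sum.inr j)) • v

/-- The highest weight of `σ` is `μ`: it is an (integral) weight of `σ`, and every weight `ν` of
`σ` is such that `μ - ν` is a sum of elements of `Φ^{c,+}`, with multiplicities `c`. -/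
def HasHighestWeight {p q : ℕ} {V : Type} [AddCommGroup V] [Module ℂ V]
    (σ : Representation ℂ (KGroup p q) V) (μ : Idx p q → ℝ) : Prop :=
  ∃ ω : Idx p q → ℤ, (∀ a, (ω a : ℝ) = μ a) ∧ IsWeight σ ω ∧
    ∀ ν : Idx p q → ℤ, IsWeight σ ν →
      ∃ c : Idx p q → Idx p q → ℕ, (∀ a b, c a b ≠ 0 → CompactPosRoot a b) ∧
        ω - ν = ∑ a, ∑ b, c a b • (Pi.single a 1 - Pi.single b 1 : Idx p q → ℤ)

/-- `σ` is (a model of) `F^K(μ)`, the continuous irreducible finite-dimensional representation of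
`K = U(p) × U(q)` with highest weight `μ`. -/
structure IsIrrepWithHighestWeight {p q : ℕ} {V : Type} [AddCommGroup V] [Module ℂ V]
    (σ : Representation ℂ (KGroup p q) V) (μ : Idx p q → ℝ) : Prop where
  finite : FiniteDimensional ℂ V
  continuous : ∀ (v : V) (φ : Module.Dual ℂ V), Continuous fun k : KGroup p q => φ (σ k v)
  irreducible : σ.IsIrreducible
  highestWeight : HasHighestWeight σ μ

/-- `[F^K(μ) : F^{K'}(μ')] ≠ 0`, that is, `Hom_{K'}(F^K(μ)|_{K'}, F^{K'}(μ')) ≠ 0`. -/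
def OccursInRestriction {m q : ℕ} (μ : Idx (m + 1) q → ℝ) (μ' : Idx m q → ℝ) : Prop :=
  ∃ (V V' : Type) (_ : AddCommGroup V) (_ : Module ℂ V) (_ : AddCommGroup V') (_ : Module ℂ V')
    (σ : Representation ℂ (KGroup (m + 1) q) V) (σ' : Representation ℂ (KGroup m q) V'),
    IsIrrepWithHighestWeight σ μ ∧ IsIrrepWithHighestWeight σ' μ' ∧
    ∃ f : Representation.IntertwiningMap
      (σ.comp (inclK m q) : Representation ℂ (KGroup m q) V) σ', f ≠ 0

/-! ### Conditions `(μ)` and `(W)` -/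

/-- Condition `(μ)`: the pattern `s` arises from some `(λ, λ')` such that the minimal `K`-types
satisfy `[μ_λ : μ'_{λ'}] ≠ 0`. -/
def CondMu (m q : ℕ) (s : List Symbol) : Prop :=
  ∃ (lam : Idx (m + 1) q → ℝ) (lam' : Idx m q → ℝ),
    IsHCParam lam ∧ IsHCParam lam' ∧ IsAssociatedSignature lam lam' s ∧ IsGGPPattern s ∧
    OccursInRestriction (blattner lam) (blattner lam')

/-- Condition `(W)`: the pattern `s` arises from some `(λ, λ')` such that
`[W_λ : W'_{λ'}] ≠ 0`, where `W_λ = F^K(λ - ρ_𝔤)` and `W'_{λ'} = F^{K'}(λ' - ρ_{𝔤'})`. -/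
def CondW (m q : ℕ) (s : List Symbol) : Prop :=
  ∃ (lam : Idx (m + 1) q → ℝ) (lam' : Idx m q → ℝ),
    IsHCParam lam ∧ IsHCParam lam' ∧ IsAssociatedSignature lam lam' s ∧ IsGGPPattern s ∧
    OccursInRestriction (coherentParam lam) (coherentParam lam')

end UnitaryGGP

/-! Everything is compared with the one-sided reduction (iii). A word reducible from the left is a
sequence of blocks `+⊕` and `⊖-` followed by one `+`.

From (W), or from (nc) and (μ), to (iii): the factor `U(q)` lies in `K'` and commutes with `U(p)`,
so a nonzero `K'`-map between irreducibles forces the two highest weights to agree on the `U(q)`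
coordinates (`OccursInRestriction.right_eq`). For the parameters `λ - ρ_𝔤` this says `λ'_{p+j} =
λ_{p+j} + 1/2`. For the Blattner parameters it says the same as soon as each `λ_{p+j}` has as many
coordinates of the first block above it as `λ'_{p+j}` has, which is what (nc) provides. The
coordinates of each parameter differ by integers, so nothing fits between the two values: each `⊖`
stands immediately before its `-`. Away from these pairs `+` and `⊕` alternate, and having one more
`+` than `⊕` forces the word to be reducible (`reduces_of_inr_eq`, `reduces_of_isChain`).

From (iii) to (W) and (μ): put the blocks at distance 2, with the two entries of a block at distance
1/2 (`exists_params_of_reduces`). Then both kinds of highest weight for `K'` arise from those for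
`K` by omitting the last coordinate of `U(p)`. No full branching law is needed: the `K'`-span of a
highest weight vector is the required constituent (`HasFunctionModel.occursInRestriction`).
Irreducible representations with a given dominant highest weight are built from products of minors
and inverse determinants, as functions on `K`. Their irreducibility follows from complete
reducibility, by averaging over the group, and from the top weight space being a line.

The combinatorial equivalences are inductions on the word. Each deleted block contributes the same
sign to `δ` and `δ'`, and the surviving `+` is the extra right end of `δ`; this gives (δ+), and with
it (q) and (nc). -/

namespace UnitaryGGP

/-! ### Continuous finite-dimensional representations of compact groups -/

open MeasureTheory in
/-- A function with values in a finite-dimensional space all of whose coefficients are integrable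
has a weak integral. -/
theorem exists_weakIntegral {X V : Type*} [MeasurableSpace X] (μ : Measure X) [AddCommGroup V]
    [Module ℂ V] [FiniteDimensional ℂ V] (F : X → V)
    (hF : ∀ φ : Module.Dual ℂ V, Integrable (fun x => φ (F x)) μ) :
    ∃ I : V, ∀ φ : Module.Dual ℂ V, φ I = ∫ x, φ (F x) ∂μ := by
  let b := Module.finBasis ℂ V
  refine ⟨∑ i, (∫ x, b.coord i (F x) ∂μ) • b i, fun φ => ?_⟩
  have h : ∀ x, φ (F x) = ∑ i, b.coord i (F x) * φ (b i) := fun x => by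
    conv_lhs => rw [← b.sum_repr (F x)]
    simp only [map_sum, map_smul, smul_eq_mul, Module.Basis.coord_apply]
  simp only [h]
  rw [integral_finsetSum _ fun i _ => (hF _).mul_const _]
  simp [integral_mul_const]

theorem eq_of_forall_dual {V : Type*} [AddCommGroup V] [Module ℂ V] {x y : V}
    (h : ∀ φ : Module.Dual ℂ V, φ x = φ y) : x = y := by
  rw [← sub_eq_zero, ← Module.forall_dual_apply_eq_zero_iff ℂ]
  intro φ
  simp [h φ]

/-- All matrix coefficients of `σ` are continuous. -/
def CoeffContinuous {G V : Type*} [Group G] [TopologicalSpace G] [AddCommGroup V] [Module ℂ V]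
    (σ : Representation ℂ G V) : Prop :=
  ∀ (v : V) (φ : Module.Dual ℂ V), Continuous fun k => φ (σ k v)

open MeasureTheory in
/-- Complete reducibility: an invariant subspace is the image of an equivariant projection. -/
theorem exists_equivariant_projection {G V : Type*} [Group G] [TopologicalSpace G]
    [IsTopologicalGroup G] [CompactSpace G] [AddCommGroup V] [Module ℂ V] [FiniteDimensional ℂ V]
    (σ : Representation ℂ G V) (hσ : CoeffContinuous σ) (N : Submodule ℂ V)
    (hN : ∀ g, ∀ x ∈ N, σ g x ∈ N) :
    ∃ P : V →ₗ[ℂ] V, (∀ x, P x ∈ N) ∧ (∀ x ∈ N, P x = x) ∧ ∀ g x, P (σ g x) = σ g (P x) := by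
  let : MeasurableSpace G := borel G
  have : BorelSpace G := ⟨rfl⟩
  let μ : Measure G := Measure.haarMeasure ⊤
  have : IsProbabilityMeasure μ := ⟨by
    have := Measure.haarMeasure_self (G := G) (K₀ := ⊤)
    simpa using this⟩
  obtain ⟨π, hπ⟩ := N.exists_isCompl
  let p : V →ₗ[ℂ] V := N.subtype ∘ₗ N.projectionOnto π hπ
  have hpN : ∀ x, p x ∈ N := fun x => by simp [p]
  have hpid : ∀ x ∈ N, p x = x := fun x hx => by
    have := Submodule.projectionOnto_apply_left hπ ⟨x, hx⟩
    simp only [p, LinearMap.comp_apply, this]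
    rfl
  let b := Module.finBasis ℂ V
  have hcont : ∀ x (φ : Module.Dual ℂ V), Continuous fun k => φ (σ k (p (σ k⁻¹ x))) := by
    intro x φ
    -- Only coefficients are known to be continuous, so the inner vector is expanded in a basis to
    -- make the integrand a finite sum of products of coefficients.
    have h : ∀ k, φ (σ k (p (σ k⁻¹ x))) =
        ∑ i, ((b.coord i) ∘ₗ p) (σ k⁻¹ x) * φ (σ k (b i)) := fun k => by
      conv_lhs => rw [← b.sum_repr (p (σ k⁻¹ x))]
      simp only [map_sum, map_smul, smul_eq_mul, Module.Basis.coord_apply, LinearMap.comp_apply]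
    simp only [h]
    exact continuous_finsetSum _ fun i _ =>
      ((hσ x _).comp continuous_inv).mul (hσ (b i) φ)
  have hint : ∀ x (φ : Module.Dual ℂ V), Integrable (fun k => φ (σ k (p (σ k⁻¹ x)))) μ :=
    fun x φ => (hcont x φ).integrable_of_hasCompactSupport (HasCompactSupport.of_compactSpace _)
  -- `P` is the Haar average of the conjugates `σ k ∘ p ∘ σ k⁻¹` of an arbitrary linear projection
  -- `p` onto `N`.
  choose P hP using fun x => exists_weakIntegral μ (fun k => σ k (p (σ k⁻¹ x))) (hint x)
  refine ⟨{ toFun := P, map_add' := ?_, map_smul' := ?_ }, ?_, ?_, ?_⟩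
  · intro x y
    refine eq_of_forall_dual fun φ => ?_
    simp only [map_add, hP]
    exact integral_add (hint x φ) (hint y φ)
  · intro c x
    refine eq_of_forall_dual fun φ => ?_
    simp only [map_smul, hP, smul_eq_mul, RingHom.id_apply]
    exact integral_const_mul _ _
  · intro x
    change P x ∈ N
    by_contra hx
    -- A functional that vanishes on `N` but not at `P x` is impossible, because the integrand takes
    -- values in `N`.
    obtain ⟨φ, hφ, hφN⟩ := Submodule.exists_dual_map_eq_bot_of_notMem hx inferInstance
    refine hφ ?_
    rw [hP]
    have : ∀ k, φ (σ k (p (σ k⁻¹ x))) = 0 := fun k => by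
      have := Submodule.mem_map_of_mem (f := φ) (hN k _ (hpN (σ k⁻¹ x)))
      rw [hφN] at this
      simpa using this
    simp [this]
  · intro x hx
    refine eq_of_forall_dual fun φ => ?_
    change φ (P x) = _
    have : ∀ k, σ k (p (σ k⁻¹ x)) = x := fun k => by
      rw [hpid _ (hN _ _ hx), ← Module.End.mul_apply, ← map_mul]
      simp
    simp [hP, this]
  · intro g x
    refine eq_of_forall_dual fun φ => ?_
    change φ (P (σ g x)) = φ (σ g (P x))
    have h1 := hP x (φ ∘ₗ σ g)
    simp only [LinearMap.comp_apply] at h1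
    -- Left invariance of Haar measure: the substitution of `g * k` for `k` cancels `σ g` on the
    -- right and releases it on the left.
    rw [hP, h1, ← integral_mul_left_eq_self _ g]
    congr 1
    funext k
    simp only [mul_inv_rev, map_mul, Module.End.mul_apply]
    congr 4
    rw [← Module.End.mul_apply (σ g⁻¹), ← map_mul]
    simp

/-- A nonzero subspace stable under a commuting family contains a common eigenvector. -/
theorem exists_common_eigenvector {ι V : Type*} [AddCommGroup V] [Module ℂ V]
    [FiniteDimensional ℂ V] (f : ι → Module.End ℂ V) (hf : ∀ i j, f i * f j = f j * f i)
    (N : Submodule ℂ V) (hN : N ≠ ⊥) (hst : ∀ i, ∀ x ∈ N, f i x ∈ N) :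
    ∃ x ∈ N, x ≠ 0 ∧ ∀ i, ∃ c : ℂ, f i x = c • x := by
  induction h : Module.finrank ℂ N using Nat.strong_induction_on generalizing N with
  | _ n ih =>
  by_cases hall : ∀ i, ∃ c : ℂ, ∀ x ∈ N, f i x = c • x
  · obtain ⟨x, hx, hx0⟩ := N.ne_bot_iff.mp hN
    exact ⟨x, hx, hx0, fun i => (hall i).imp fun c hc => hc x hx⟩
  · push Not at hall
    obtain ⟨i, hi⟩ := hall
    have : Nontrivial N := N.nontrivial_iff_ne_bot.mpr hN
    obtain ⟨c, hc⟩ := Module.End.exists_eigenvalue ((f i).restrict (hst i))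
    obtain ⟨y, hy⟩ := hc.exists_hasEigenvector
    obtain ⟨z, hz, hzc⟩ := hi c
    -- An operator that is not scalar on `N` has an eigenspace cutting out a proper nonzero
    -- subspace. Commutation keeps it stable, so the dimension induction applies.
    let N' := N ⊓ (f i).eigenspace c
    have hlt : N' < N := lt_of_le_of_ne inf_le_left fun h => hzc (by
      have hz' : z ∈ N' := h ▸ hz
      exact Module.End.mem_eigenspace_iff.mp hz'.2)
    have hy' : (y : V) ∈ N' := ⟨y.2, Module.End.mem_eigenspace_iff.mpr (by
      have := congrArg Subtype.val hy.apply_eq_smul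
      simpa using this)⟩
    have hne : N' ≠ ⊥ := N'.ne_bot_iff.mpr ⟨y, hy', by simpa using hy.2⟩
    obtain ⟨x, hx, hx0, hxe⟩ := ih _ (h ▸ Submodule.finrank_lt_finrank_of_lt hlt) N' hne (by
      intro j x hx
      refine ⟨hst j x hx.1, Module.End.mem_eigenspace_iff.mpr ?_⟩
      rw [← Module.End.mul_apply, hf, Module.End.mul_apply,
        Module.End.mem_eigenspace_iff.mp hx.2, map_smul]) rfl
    exact ⟨x, hx.1, hx0, hxe⟩

/-- Irreducibility in terms of invariant subspaces. -/
theorem isIrreducible_of_submodule {G V : Type*} [Group G] [AddCommGroup V] [Module ℂ V]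
    (σ : Representation ℂ G V) [Nontrivial V]
    (h : ∀ N : Submodule ℂ V, (∀ g, ∀ x ∈ N, σ g x ∈ N) → N = ⊥ ∨ N = ⊤) :
    σ.IsIrreducible where
  exists_pair_ne := ⟨⊥, ⊤, fun hbt => bot_ne_top (α := Submodule ℂ V)
    (congrArg Subrepresentation.toSubmodule hbt)⟩
  eq_bot_or_eq_top N := (h N.toSubmodule fun g x hx => N.apply_mem_toSubmodule g hx).imp
    (fun h => Subrepresentation.toSubmodule_injective h)
    (fun h => Subrepresentation.toSubmodule_injective h)

theorem eq_bot_or_eq_top_of_isIrreducible {G V : Type*} [Group G] [AddCommGroup V] [Module ℂ V]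
    {σ : Representation ℂ G V} (hσ : σ.IsIrreducible)
    (N : Submodule ℂ V) (hN : ∀ g, ∀ x ∈ N, σ g x ∈ N) : N = ⊥ ∨ N = ⊤ :=
  (hσ.eq_bot_or_eq_top ⟨N, fun g _ hx => hN g _ hx⟩).imp
    (congrArg Subrepresentation.toSubmodule) (congrArg Subrepresentation.toSubmodule)

/-! ### Characters of the circle -/

/-- A continuous character of the circle is a power. -/
theorem exists_zpow_of_continuous_character (χ : Circle → ℂ) (hχ : Continuous χ) (h1 : χ 1 = 1)
    (hmul : ∀ x y, χ (x * y) = χ x * χ y) : ∃ n : ℤ, ∀ z : Circle, χ z = (z : ℂ) ^ n := by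
  have : Fact (0 < 2 * Real.pi) := ⟨Real.two_pi_pos⟩
  let f : C(AddCircle (2 * Real.pi), ℂ) :=
    ⟨fun t => χ (AddCircle.toCircle t), hχ.comp AddCircle.continuous_toCircle⟩
  have hfadd : ∀ s t, f (s + t) = f s * f t := fun s t => by
    simp [f, AddCircle.toCircle_add, hmul]
  have hf0 : f 0 = 1 := by simp [f, h1]
  by_contra! hne
  -- Translation by a point `s` where `f` differs from the `n`-th power multiplies the `n`-th
  -- Fourier coefficient by a factor other than 1, so that coefficient is 0. If this happens for all
  -- `n`, the Fourier series sums to 0 at the origin, where `f` is 1.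
  have hzero : ∀ n : ℤ, fourierCoeff f n = 0 := by
    intro n
    obtain ⟨z, hz⟩ := hne n
    obtain ⟨s, rfl⟩ : ∃ s : AddCircle (2 * Real.pi), AddCircle.toCircle s = z :=
      by
      obtain ⟨s, hs⟩ := (AddCircle.homeomorphCircle Real.two_pi_pos.ne').surjective z
      exact ⟨s, by rw [← hs, AddCircle.homeomorphCircle_apply]⟩
    have hs : fourier (-n) s * f s ≠ 1 := by
      intro h
      apply hz
      change f s = _
      have hn : ((AddCircle.toCircle s : Circle) : ℂ) ^ n = fourier n s := by
        rw [fourier_apply, AddCircle.toCircle_zsmul]; simp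
      rw [hn]
      have h2 : fourier n s * fourier (-n) s = 1 := by
        rw [← fourier_add']; simp
      calc f s = (fourier n s * fourier (-n) s) * f s := by rw [h2, one_mul]
        _ = fourier n s * (fourier (-n) s * f s) := by ring
        _ = _ := by rw [h, mul_one]
    have key : fourierCoeff f n = (fourier (-n) s * f s) * fourierCoeff f n := by
      unfold fourierCoeff
      rw [← MeasureTheory.integral_const_mul]
      rw [← MeasureTheory.integral_add_left_eq_self _ s]
      congr 1
      funext t
      rw [hfadd]
      simp only [smul_eq_mul, fourier_apply, smul_add, AddCircle.toCircle_add, Circle.coe_mul]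
      ring
    have : (fourier (-n) s * f s - 1) * fourierCoeff f n = 0 := by
      rw [sub_mul, ← key, one_mul, sub_self]
    exact (mul_eq_zero.mp this).resolve_left (sub_ne_zero.mpr hs)
  have hsum : Summable (fourierCoeff f) := by
    simp [funext hzero, summable_zero]
  have := has_pointwise_sum_fourier_series_of_summable hsum 0
  simp only [hzero, zero_smul, hf0] at this
  exact one_ne_zero (this.unique hasSum_zero)

/-! ### Compactness of `K` -/

theorem isCompact_unitaryGroup (n : ℕ) :
    IsCompact (Matrix.unitaryGroup (Fin n) ℂ : Set (Matrix (Fin n) (Fin n) ℂ)) := by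
  refine IsCompact.of_isClosed_subset
    (s := Set.pi Set.univ fun _ => Set.pi Set.univ fun _ => Metric.closedBall (0 : ℂ) 1)
    (isCompact_univ_pi fun _ => isCompact_univ_pi fun _ => isCompact_closedBall _ _) ?_ ?_
  · have : (Matrix.unitaryGroup (Fin n) ℂ : Set (Matrix (Fin n) (Fin n) ℂ)) =
        {A | A * star A = 1} := by
      ext A
      exact Matrix.mem_unitaryGroup_iff
    rw [this]
    exact isClosed_eq (by fun_prop) continuous_const
  · intro A hA i _ j _
    simpa using entry_norm_bound_of_unitary hA i j

instance (n : ℕ) : CompactSpace (Matrix.unitaryGroup (Fin n) ℂ) :=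
  isCompact_iff_compactSpace.mp (isCompact_unitaryGroup n)

/-! ### The diagonal torus and its weights -/

/-- The diagonal unitary matrix with given entries. -/
def diagU (n : ℕ) : (Fin n → Circle) →* Matrix.unitaryGroup (Fin n) ℂ where
  toFun z := ⟨Matrix.diagonal fun i => (z i : ℂ), by
    rw [Matrix.mem_unitaryGroup_iff, Matrix.star_eq_conjTranspose, Matrix.diagonal_conjTranspose,
      Matrix.diagonal_mul_diagonal, ← Matrix.diagonal_one]
    congr 1
    funext i
    simp [Complex.mul_conj, Circle.normSq_coe]⟩
  map_one' := by apply Subtype.ext; simp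
  map_mul' z w := by apply Subtype.ext; simp [Matrix.diagonal_mul_diagonal]

theorem coe_diagU {n : ℕ} (z : Fin n → Circle) :
    (diagU n z : Matrix (Fin n) (Fin n) ℂ) = Matrix.diagonal fun i => (z i : ℂ) := rfl

theorem continuous_diagU (n : ℕ) : Continuous (diagU n) :=
  Continuous.subtype_mk (by fun_prop) _

theorem exists_diagU_eq {n : ℕ} (g : Matrix.unitaryGroup (Fin n) ℂ)
    (hg : (g : Matrix (Fin n) (Fin n) ℂ).IsDiag) : ∃ z, diagU n z = g := by
  have hd := hg.diagonal_diag
  have h := Matrix.mem_unitaryGroup_iff.mp g.2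
  rw [← hd, Matrix.star_eq_conjTranspose, Matrix.diagonal_conjTranspose,
    Matrix.diagonal_mul_diagonal, ← Matrix.diagonal_one] at h
  have h1 : ∀ i, (g : Matrix (Fin n) (Fin n) ℂ) i i ∈ Submonoid.unitSphere ℂ := fun i => by
    have : (g : Matrix (Fin n) (Fin n) ℂ) i i * starRingEnd ℂ ((g : Matrix _ _ ℂ) i i) = 1 :=
      congrFun (Matrix.diagonal_injective h) i
    rw [Submonoid.unitSphere, Submonoid.mem_mk]
    change _ ∈ Metric.sphere (0 : ℂ) 1
    rw [mem_sphere_zero_iff_norm]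
    rw [Complex.mul_conj] at this
    rw [← sq_eq_sq₀ (norm_nonneg _) zero_le_one, one_pow, ← Complex.normSq_eq_norm_sq]
    exact_mod_cast this
  refine ⟨fun i => ⟨_, h1 i⟩, Subtype.ext ?_⟩
  exact hd

/-- The diagonal torus of `K`. -/
noncomputable def torus (p q : ℕ) : (Idx p q → Circle) →* KGroup p q where
  toFun t := (diagU p fun i => t (.inl i), diagU q fun j => t (.inr j))
  map_one' := Prod.ext (map_one (diagU p)) (map_one (diagU q))
  map_mul' s t := Prod.ext (map_mul (diagU p) (fun i => s (.inl i)) fun i => t (.inl i))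
    (map_mul (diagU q) (fun j => s (.inr j)) fun j => t (.inr j))

theorem torus_apply {p q : ℕ} (t : Idx p q → Circle) :
    torus p q t = (diagU p fun i => t (.inl i), diagU q fun j => t (.inr j)) := rfl

theorem continuous_torus (p q : ℕ) : Continuous (torus p q) :=
  ((continuous_diagU p).comp (by fun_prop)).prodMk ((continuous_diagU q).comp (by fun_prop))

/-- The character of the torus with exponents `ν`. -/
noncomputable def torusChar {ι : Type*} [Fintype ι] (ν : ι → ℤ) (t : ι → Circle) : ℂ :=
  ∏ a, (t a : ℂ) ^ ν a

theorem torusChar_add {ι : Type*} [Fintype ι] (ν ν' : ι → ℤ) (t : ι → Circle) :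
    torusChar (ν + ν') t = torusChar ν t * torusChar ν' t := by
  simp only [torusChar, ← Finset.prod_mul_distrib, Pi.add_apply]
  exact Finset.prod_congr rfl fun a _ => zpow_add₀ (t a).coe_ne_zero _ _

theorem torusChar_sumElim {p q : ℕ} (ν : Idx p q → ℤ) (t : Idx p q → Circle) :
    torusChar ν t = (∏ i, (t (.inl i) : ℂ) ^ ν (.inl i)) * ∏ j, (t (.inr j) : ℂ) ^ ν (.inr j) :=
  Fintype.prod_sum_type _

theorem torusChar_injective {ι : Type*} [Fintype ι] {ν ν' : ι → ℤ}
    (h : ∀ t, torusChar ν t = torusChar ν' t) : ν = ν' := by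
  classical
  funext a
  by_contra hne
  have hn : ((ν a - ν' a : ℤ) : ℝ) ≠ 0 := by exact_mod_cast sub_ne_zero.mpr hne
  -- This `z` has `(ν a - ν' a)`-th power equal to `-1`, so it separates the two characters on the
  -- circle of coordinate `a`.
  let z : Circle := Circle.exp (Real.pi / (ν a - ν' a : ℤ))
  have hz : ∀ μ : ι → ℤ, torusChar μ (Pi.mulSingle a z) = (z : ℂ) ^ μ a := by
    intro μ
    rw [torusChar, Finset.prod_eq_single a]
    · simp
    · intro b _ hb; simp [Pi.mulSingle_eq_of_ne hb]
    · simp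
  have h1 := h (Pi.mulSingle a z)
  rw [hz, hz] at h1
  have h2 : z ^ (ν a - ν' a) = 1 := by
    apply Circle.ext
    rw [Circle.coe_zpow, zpow_sub₀ z.coe_ne_zero, h1, div_self (zpow_ne_zero _ z.coe_ne_zero)]
    rfl
  rw [← Circle.exp_zsmul, zsmul_eq_mul, mul_div_cancel₀ _ hn] at h2
  have h3 := congrArg (fun w : Circle => (w : ℂ)) h2
  simp only [Circle.coe_exp, Circle.coe_one, Complex.exp_pi_mul_I] at h3
  norm_num at h3

/-- `v` is zero or a weight vector of weight `ν`. -/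
def IsWeightVector {p q : ℕ} {V : Type*} [AddCommGroup V] [Module ℂ V]
    (σ : Representation ℂ (KGroup p q) V) (ν : Idx p q → ℤ) (v : V) : Prop :=
  ∀ t, σ (torus p q t) v = torusChar ν t • v

/-- Every diagonal unitary matrix comes from a point of the product of circles, so testing on
diagonal elements of `K` and testing on `torus` are the same. -/
theorem isWeight_iff {p q : ℕ} {V : Type} [AddCommGroup V] [Module ℂ V]
    (σ : Representation ℂ (KGroup p q) V) (ν : Idx p q → ℤ) :
    IsWeight σ ν ↔ ∃ v, v ≠ 0 ∧ IsWeightVector σ ν v := by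
  refine exists_congr fun v => and_congr_right fun _ => ⟨fun h t => ?_, fun h t h1 h2 => ?_⟩
  · rw [h _ (Matrix.isDiag_diagonal _) (Matrix.isDiag_diagonal _), torusChar_sumElim]
    simp [torus_apply, coe_diagU]
  · obtain ⟨z, hz⟩ := exists_diagU_eq t.1 h1
    obtain ⟨w, hw⟩ := exists_diagU_eq t.2 h2
    have : t = torus p q (Sum.elim z w) := by
      rw [torus_apply]; exact Prod.ext hz.symm hw.symm
    rw [this, h, torusChar_sumElim]
    simp [torus_apply, coe_diagU]

/-- A nonzero subspace stable under the torus contains a vector of integral weight. -/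
theorem exists_isWeightVector {p q : ℕ} {V : Type*} [AddCommGroup V] [Module ℂ V]
    [FiniteDimensional ℂ V] {σ : Representation ℂ (KGroup p q) V} (hσ : CoeffContinuous σ)
    (N : Submodule ℂ V) (hN : N ≠ ⊥) (hst : ∀ t, ∀ x ∈ N, σ (torus p q t) x ∈ N) :
    ∃ x ∈ N, x ≠ 0 ∧ ∃ ν, IsWeightVector σ ν x := by
  obtain ⟨x, hx, hx0, hc⟩ := exists_common_eigenvector (fun t => σ (torus p q t))
    (fun s t => by rw [← map_mul, ← map_mul, ← map_mul, ← map_mul, mul_comm]) N hN hst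
  choose c hc using hc
  obtain ⟨φ, hφ⟩ : ∃ φ : Module.Dual ℂ V, φ x = 1 := by
    obtain ⟨φ, hφ⟩ := not_forall.mp (mt (Module.forall_dual_apply_eq_zero_iff ℂ x).mp hx0)
    exact ⟨(φ x)⁻¹ • φ, by simp [inv_mul_cancel₀ hφ]⟩
  have hcφ : ∀ t, c t = φ (σ (torus p q t) x) := fun t => by simp [hc, hφ]
  -- The eigenvalues form a character, which is continuous because it is the matrix coefficient of
  -- `x` against a functional with `φ x = 1`. On each coordinate circle it is therefore a power.
  let χ : (Idx p q → Circle) →* ℂ :=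
    { toFun := c
      map_one' := by rw [hcφ, map_one, map_one, Module.End.one_apply, hφ]
      map_mul' := fun s t => by
        rw [hcφ, map_mul, map_mul, Module.End.mul_apply, hc t, map_smul, hc s]
        simp [hφ, mul_comm] }
  have hχ : Continuous χ := by
    have : (χ : (Idx p q → Circle) → ℂ) = fun t => φ (σ (torus p q t) x) := funext hcφ
    rw [this]
    exact (hσ x φ).comp (continuous_torus p q)
  have key : ∀ a, ∃ n : ℤ, ∀ z : Circle, χ (Pi.mulSingle a z) = (z : ℂ) ^ n := fun a =>
    exists_zpow_of_continuous_character (fun z => χ (Pi.mulSingle a z))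
      (hχ.comp (continuous_mulSingle (A := fun _ => Circle) a)) (by simp) (fun z w => by
        rw [Pi.mulSingle_mul, map_mul])
  choose ν hν using key
  refine ⟨x, hx, hx0, ν, fun t => ?_⟩
  rw [hc]
  congr 1
  change χ t = _
  conv_lhs => rw [← Finset.univ_prod_mulSingle t]
  rw [map_prod]
  exact Finset.prod_congr rfl fun a _ => hν a (t a)

/-! ### Sums of compact positive roots -/

/-- `x` is a sum of compact positive roots. -/
def IsPosSum {p q : ℕ} (x : Idx p q → ℤ) : Prop :=
  ∃ c : Idx p q → Idx p q → ℕ, (∀ a b, c a b ≠ 0 → CompactPosRoot a b) ∧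
    x = ∑ a, ∑ b, c a b • (Pi.single a 1 - Pi.single b 1 : Idx p q → ℤ)

theorem sum_smul_root_apply {p q : ℕ} (c : Idx p q → Idx p q → ℕ) (d : Idx p q) :
    (∑ a, ∑ b, c a b • (Pi.single a 1 - Pi.single b 1 : Idx p q → ℤ)) d =
      ∑ a, ∑ b, (c a b : ℤ) * ((if d = a then 1 else 0) - if d = b then 1 else 0) := by
  simp [Finset.sum_apply, Pi.single_apply]

theorem sum_mul_sum_smul_root {p q : ℕ} (h : Idx p q → ℤ) (c : Idx p q → Idx p q → ℕ) :
    ∑ d, h d * (∑ a, ∑ b, c a b • (Pi.single a 1 - Pi.single b 1 : Idx p q → ℤ)) d =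
      ∑ a, ∑ b, (c a b : ℤ) * (h a - h b) := by
  simp only [sum_smul_root_apply, Finset.mul_sum]
  rw [Finset.sum_comm]
  refine Finset.sum_congr rfl fun a _ => ?_
  rw [Finset.sum_comm]
  refine Finset.sum_congr rfl fun b _ => ?_
  simp only [mul_left_comm (h _), ← Finset.mul_sum, mul_sub, Finset.sum_sub_distrib]
  simp

/-- The functional `h` is nonpositive on every compact positive root, hence on the cone they span.
-/
theorem IsPosSum.sum_mul_nonpos {p q : ℕ} {x : Idx p q → ℤ} (hx : IsPosSum x) (h : Idx p q → ℤ)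
    (hh : ∀ a b, CompactPosRoot a b → h a ≤ h b) : ∑ d, h d * x d ≤ 0 := by
  obtain ⟨c, hc, rfl⟩ := hx
  rw [sum_mul_sum_smul_root]
  refine Finset.sum_nonpos fun a _ => Finset.sum_nonpos fun b _ => ?_
  by_cases h0 : c a b = 0
  · simp [h0]
  · exact mul_nonpos_of_nonneg_of_nonpos (Int.natCast_nonneg _)
      (sub_nonpos.mpr (hh a b (hc a b h0)))

/-- This is the equality case of the preceding inequality. All terms have one sign, so a root on
which `h` is strictly negative has multiplicity 0; if all the roots involving `d` are such, nothing
contributes to coordinate `d`. -/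
theorem IsPosSum.apply_eq_zero {p q : ℕ} {x : Idx p q → ℤ} (hx : IsPosSum x) (h : Idx p q → ℤ)
    (hh : ∀ a b, CompactPosRoot a b → h a ≤ h b) (h0 : ∑ d, h d * x d = 0) (d : Idx p q)
    (hd : ∀ a b, CompactPosRoot a b → d = a ∨ d = b → h a < h b) : x d = 0 := by
  obtain ⟨c, hc, rfl⟩ := hx
  rw [sum_mul_sum_smul_root] at h0
  have hle : ∀ a b, (c a b : ℤ) * (h a - h b) ≤ 0 := fun a b => by
    by_cases h0 : c a b = 0
    · simp [h0]
    · exact mul_nonpos_of_nonneg_of_nonpos (Int.natCast_nonneg _)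
        (sub_nonpos.mpr (hh a b (hc a b h0)))
  have hz : ∀ a b, (c a b : ℤ) * (h a - h b) = 0 := fun a b =>
    (Finset.sum_eq_zero_iff_of_nonpos fun b _ => hle a b).mp
      ((Finset.sum_eq_zero_iff_of_nonpos fun a _ => Finset.sum_nonpos fun b _ => hle a b).mp h0 a
        (Finset.mem_univ a)) b (Finset.mem_univ b)
  rw [sum_smul_root_apply]
  refine Finset.sum_eq_zero fun a _ => Finset.sum_eq_zero fun b _ => ?_
  by_cases hab : c a b = 0
  · simp [hab]
  by_cases hda : d = a ∨ d = b
  · have h1 := hd a b (hc a b hab) hda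
    rcases mul_eq_zero.mp (hz a b) with h2 | h2
    · exact absurd (by exact_mod_cast h2) hab
    · omega
  · push Not at hda
    simp [hda.1, hda.2]

theorem IsPosSum.zero {p q : ℕ} : IsPosSum (0 : Idx p q → ℤ) :=
  ⟨0, fun _ _ h => absurd rfl h, by simp⟩

theorem IsPosSum.add {p q : ℕ} {x y : Idx p q → ℤ} (hx : IsPosSum x) (hy : IsPosSum y) :
    IsPosSum (x + y) := by
  obtain ⟨c, hc, rfl⟩ := hx
  obtain ⟨d, hd, rfl⟩ := hy
  refine ⟨c + d, fun a b h => ?_, ?_⟩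
  · by_cases h0 : c a b = 0
    · exact hd a b fun h1 => h (by simp [h0, h1])
    · exact hc a b h0
  · simp only [Pi.add_apply, add_smul, Finset.sum_add_distrib]

/-- The cone of sums of compact positive roots is pointed. -/
theorem IsPosSum.eq_zero_of_add {p q : ℕ} {x y : Idx p q → ℤ} (hx : IsPosSum x)
    (hy : IsPosSum y) (hxy : x + y = 0) : x = 0 := by
  -- The index inside its own factor increases strictly along every compact positive root.
  let h : Idx p q → ℤ := Sum.elim (fun i => (i : ℤ)) fun j => (j : ℤ)
  have hlt : ∀ a b : Idx p q, CompactPosRoot a b → h a < h b := by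
    rintro (a | a) (b | b) hab
    · exact Int.ofNat_lt.mpr (show a < b from hab)
    · exact hab.elim
    · exact hab.elim
    · exact Int.ofNat_lt.mpr (show a < b from hab)
  have hle := fun a b hab => (hlt a b hab).le
  have h1 := hx.sum_mul_nonpos h hle
  have h2 := hy.sum_mul_nonpos h hle
  have h3 : ∑ d, h d * x d + ∑ d, h d * y d = 0 := by
    rw [← Finset.sum_add_distrib]
    refine Finset.sum_eq_zero fun d _ => ?_
    rw [← mul_add, ← Pi.add_apply, hxy]
    simp
  funext d
  exact hx.apply_eq_zero h hle (by omega) d fun a b hab _ => hlt a b hab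

/-! ### Branching preserves the `U(q)`-part of the highest weight -/

theorem continuous_inclU (m : ℕ) : Continuous (inclU m) := by
  refine Continuous.subtype_mk ?_ _
  refine Continuous.matrix_reindex ?_ _ _
  exact Continuous.matrix_fromBlocks continuous_subtype_val continuous_const continuous_const
    continuous_const

theorem continuous_inclK (m q : ℕ) : Continuous (inclK m q) :=
  ((continuous_inclU m).comp continuous_fst).prodMk continuous_snd

/-- A weight of the torus of `U(q)` extends to a weight of the torus of `K`. -/
theorem exists_isWeight_of_right {p q : ℕ} {V : Type} [AddCommGroup V] [Module ℂ V]
    [FiniteDimensional ℂ V] {σ : Representation ℂ (KGroup p q) V} (hσ : CoeffContinuous σ)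
    (n : Fin q → ℤ) {v : V} (hv : v ≠ 0) (h : ∀ t, σ (1, diagU q t) v = torusChar n t • v) :
    ∃ ν, IsWeight σ ν ∧ ∀ j, ν (.inr j) = n j := by
  -- The joint eigenspace of the torus of `U(q)` is stable under the full commutative torus, so it
  -- contains a full weight vector.
  let E : Submodule ℂ V := ⨅ t, Module.End.eigenspace (σ (1, diagU q t)) (torusChar n t)
  have hE : ∀ x, x ∈ E ↔ ∀ t, σ (1, diagU q t) x = torusChar n t • x := fun x => by
    simp [E, Submodule.mem_iInf]
  obtain ⟨x, hx, hx0, ν, hν⟩ := exists_isWeightVector hσ E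
    (E.ne_bot_iff.mpr ⟨v, (hE v).mpr h, hv⟩) (by
      intro s x hx
      rw [hE] at hx ⊢
      intro t
      rw [← Module.End.mul_apply, ← map_mul]
      have : ((1, diagU q t) : KGroup p q) * torus p q s = torus p q s * (1, diagU q t) := by
        rw [torus_apply, Prod.mk_mul_mk, Prod.mk_mul_mk, one_mul, mul_one, ← map_mul, ← map_mul,
          mul_comm]
      rw [this, map_mul, Module.End.mul_apply, hx, map_smul])
  refine ⟨ν, (isWeight_iff σ ν).mpr ⟨x, hx0, hν⟩, fun j => ?_⟩
  have : (fun j => ν (.inr j)) = n := torusChar_injective fun t => by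
    have h1 := hν (Sum.elim 1 t)
    have h2 : torus p q (Sum.elim 1 t) = (1, diagU q t) := by
      rw [torus_apply]
      exact Prod.ext (map_one (diagU p)) rfl
    rw [h2, (hE x).mp hx t, torusChar_sumElim] at h1
    have h3 := smul_left_injective ℂ hx0 h1
    simpa [torusChar] using h3.symm
  exact congrFun this j

theorem IsIrrepWithHighestWeight.coeffContinuous {p q : ℕ} {V : Type} [AddCommGroup V]
    [Module ℂ V] {σ : Representation ℂ (KGroup p q) V} {μ : Idx p q → ℝ}
    (h : IsIrrepWithHighestWeight σ μ) : CoeffContinuous σ := h.continuous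

theorem IsWeightVector.right {p q : ℕ} {V : Type*} [AddCommGroup V] [Module ℂ V]
    {σ : Representation ℂ (KGroup p q) V} {ν : Idx p q → ℤ} {v : V} (hv : IsWeightVector σ ν v)
    (t : Fin q → Circle) : σ (1, diagU q t) v = torusChar (fun j => ν (.inr j)) t • v := by
  have h1 := hv (Sum.elim 1 t)
  have h2 : torus p q (Sum.elim 1 t) = (1, diagU q t) := by
    rw [torus_apply]
    exact Prod.ext (map_one (diagU p)) rfl
  rw [h2, torusChar_sumElim] at h1
  simpa [torusChar] using h1

theorem inclK_one_right {m q : ℕ} (h : Matrix.unitaryGroup (Fin q) ℂ) :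
    inclK m q (1, h) = (1, h) := Prod.ext (map_one (inclU m)) rfl

/-- The `U(q)`-part of each highest weight is shown to occur as the `U(q)`-part of a weight of the
other representation. Each is then dominated by the other, and the cone of positive sums is pointed.
-/
theorem OccursInRestriction.right_eq {m q : ℕ} {μ : Idx (m + 1) q → ℝ} {μ' : Idx m q → ℝ}
    (hocc : OccursInRestriction μ μ') (j : Fin q) : μ (.inr j) = μ' (.inr j) := by
  obtain ⟨V, V', _, _, _, _, σ, σ', hσ, hσ', f, hf⟩ := hocc
  have := hσ.finite
  have := hσ'.finite
  have := hσ'.irreducible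
  have hfσ : ∀ k x, f (σ (inclK m q k) x) = σ' k (f x) := fun k x =>
    Representation.IntertwiningMap.isIntertwining _ _ f k x
  have hsurj := (Representation.IsIrreducible.surjective_or_eq_zero f).resolve_right hf
  obtain ⟨ω, hω, hvω, hωle⟩ := hσ.highestWeight
  obtain ⟨ω', hω', hvω', hωle'⟩ := hσ'.highestWeight
  obtain ⟨v, hv0, hv⟩ := (isWeight_iff σ ω).mp hvω
  obtain ⟨v', hv0', hv'⟩ := (isWeight_iff σ' ω').mp hvω'
  -- A preimage of `v'` in an invariant complement of `ker f` transforms under the torus of `U(q)`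
  -- exactly as `v'` does.
  obtain ⟨ν, hν, hνω'⟩ : ∃ ν, IsWeight σ ν ∧ ∀ j, ν (.inr j) = ω' (.inr j) := by
    obtain ⟨P, hP1, hP2, hP3⟩ := exists_equivariant_projection
      (σ.comp (inclK m q) : Representation ℂ (KGroup m q) V)
      (fun v φ => (hσ.coeffContinuous v φ).comp (continuous_inclK m q))
      (LinearMap.ker f.toLinearMap) (fun g x hx => by
        have hx' : f x = 0 := hx
        change f (σ (inclK m q g) x) = 0
        rw [hfσ, hx', map_zero])
    have hP1' : ∀ x, f (P x) = 0 := hP1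
    have hP2' : ∀ x, f x = 0 → P x = x := hP2
    obtain ⟨y, hy⟩ := hsurj v'
    have hfc : f (y - P y) = v' := by rw [map_sub, hP1', hy, sub_zero]
    have hPc : P (y - P y) = 0 := by rw [map_sub, hP2' _ (hP1' y), sub_self]
    refine exists_isWeight_of_right hσ.coeffContinuous (fun j => ω' (.inr j)) (v := y - P y)
      (fun h => hv0' (by rw [← hfc, h, map_zero])) fun t => ?_
    have h1 := hP3 (1, diagU q t) (y - P y)
    rw [MonoidHom.comp_apply, inclK_one_right, hPc, map_zero] at h1
    have h2 := hP2' (σ (1, diagU q t) (y - P y) - torusChar (fun j => ω' (.inr j)) t • (y - P y))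
      (by rw [map_sub, map_smul, ← inclK_one_right, hfσ, hfc, hv'.right, sub_self])
    rw [map_sub, map_smul, h1, hPc, smul_zero, sub_zero] at h2
    exact sub_eq_zero.mp h2.symm
  obtain ⟨ν', hν', hνω⟩ : ∃ ν', IsWeight σ' ν' ∧ ∀ j, ν' (.inr j) = ω (.inr j) := by
    -- The vectors all of whose `K`-translates are killed by `f` form an invariant subspace. By
    -- irreducibility it is zero, since `f` is surjective onto a nonzero space.
    obtain ⟨g, hg⟩ : ∃ k : KGroup (m + 1) q, f (σ k v) ≠ 0 := by
      by_contra! hall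
      let N : Submodule ℂ V := ⨅ k, LinearMap.ker (f.toLinearMap ∘ₗ σ k)
      have hN : ∀ x, x ∈ N ↔ ∀ k, f (σ k x) = 0 := fun x => by
        simp [N, Submodule.mem_iInf]
      rcases eq_bot_or_eq_top_of_isIrreducible hσ.irreducible N (fun g x hx => by
        rw [hN] at hx ⊢
        intro k
        rw [← Module.End.mul_apply, ← map_mul]
        exact hx _) with h | h
      · exact hv0 (by rw [← Submodule.mem_bot ℂ, ← h]; exact (hN v).mpr hall)
      · refine hv0' ?_
        obtain ⟨y, hy⟩ := hsurj v'
        have := (hN y).mp (h ▸ Submodule.mem_top) 1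
        rw [map_one, Module.End.one_apply] at this
        rw [← hy, this]
    -- The `U(q)`-component of `g` lies in `K'` and passes through `f`, so it can be dropped. What
    -- remains commutes with `U(q)` and keeps the `U(q)`-weight of `v`.
    have hgf : f (σ (g.1, 1) v) ≠ 0 := by
      intro h0
      apply hg
      have : g = (1, g.2) * (g.1, 1) := by simp
      rw [this, map_mul, Module.End.mul_apply, ← inclK_one_right, hfσ, h0, map_zero]
    refine exists_isWeight_of_right hσ'.coeffContinuous (fun j => ω (.inr j)) hgf fun t => ?_
    rw [← hfσ, inclK_one_right, ← Module.End.mul_apply, ← map_mul]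
    have : ((1, diagU q t) : KGroup (m + 1) q) * (g.1, 1) = (g.1, 1) * (1, diagU q t) := by simp
    rw [this, map_mul, Module.End.mul_apply, hv.right, map_smul, map_smul]
  have hx : IsPosSum (ω - ν) := hωle ν hν
  have hy : IsPosSum (ω' - ν') := hωle' ν' hν'
  -- This functional ignores the unitary factor that shrinks and is strict on the roots of `U(q)`.
  -- The differences `ω - ν` and `ω' - ν'` have opposite `U(q)`-parts, so both pairings, being
  -- nonpositive with sum 0, vanish.
  let h (p : ℕ) : Idx p q → ℤ := Sum.elim 0 fun j => (j : ℤ)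
  have hle : ∀ p, ∀ a b : Idx p q, CompactPosRoot a b → h p a ≤ h p b := by
    rintro p (a | a) (b | b) hab
    · exact le_rfl
    · exact hab.elim
    · exact hab.elim
    · exact Int.ofNat_le.mpr (show a < b from hab).le
  have h1 := hx.sum_mul_nonpos _ (hle _)
  have h2 := hy.sum_mul_nonpos _ (hle _)
  have h3 : ∑ d, h (m + 1) d * (ω - ν) d + ∑ d, h m d * (ω' - ν') d = 0 := by
    simp only [h, Fintype.sum_sum_type, Sum.elim_inl, Sum.elim_inr, Pi.zero_apply, zero_mul,
      Finset.sum_const_zero, zero_add, Pi.sub_apply, hνω, hνω', ← Finset.sum_add_distrib]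
    exact Finset.sum_eq_zero fun j _ => by ring
  have h4 := hx.apply_eq_zero _ (hle _) (by omega) (.inr j) (by
    rintro (a | a) (b | b) hab hj
    · simp at hj
    · exact hab.elim
    · exact hab.elim
    · exact Int.ofNat_lt.mpr (show a < b from hab))
  rw [Pi.sub_apply, hνω', sub_eq_zero] at h4
  rw [← hω, ← hω', h4]

/-! ### Functions on `K` under right translation -/

/-- Right translation on the functions on a group. -/
def rightRegular (G : Type*) [Group G] : Representation ℂ G (G → ℂ) where
  toFun g := LinearMap.funLeft ℂ ℂ fun x => x * g
  map_one' := by ext f x; simp [LinearMap.funLeft_apply]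
  map_mul' g h := by
    apply LinearMap.ext
    intro f
    funext x
    simp [LinearMap.funLeft_apply, mul_assoc]

theorem rightRegular_apply {G : Type*} [Group G] (g : G) (f : G → ℂ) (x : G) :
    rightRegular G g f x = f (x * g) := rfl

theorem rightRegular_mul {G : Type*} [Group G] (g : G) (f f' : G → ℂ) :
    rightRegular G g (f * f') = rightRegular G g f * rightRegular G g f' := rfl

/-- There are a finite-dimensional space of continuous functions on `K`, stable under right
translation, and a spanning set of weight vectors in it with weights at most `μ`, such that those
of weight `μ` are multiples of a function with value `1` at `1`. -/
def HasFunctionModel {p q : ℕ} (μ : Idx p q → ℤ) : Prop :=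
  ∃ (S : Set (KGroup p q → ℂ)) (v : KGroup p q → ℂ), S.Finite ∧ (∀ f ∈ S, Continuous f) ∧
    (∀ g, ∀ f ∈ S, rightRegular _ g f ∈ Submodule.span ℂ S) ∧
    v ∈ S ∧ v 1 = 1 ∧ IsWeightVector (rightRegular _) μ v ∧
    ∀ f ∈ S, f ≠ 0 → ∃ ν, IsWeightVector (rightRegular _) ν f ∧ IsPosSum (μ - ν) ∧
      (ν = μ → f ∈ Submodule.span ℂ {v})

theorem IsWeightVector.mul {p q : ℕ} {ν ν' : Idx p q → ℤ} {f f' : KGroup p q → ℂ}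
    (hf : IsWeightVector (rightRegular _) ν f) (hf' : IsWeightVector (rightRegular _) ν' f') :
    IsWeightVector (rightRegular _) (ν + ν') (f * f') := fun t => by
  rw [rightRegular_mul, hf, hf', torusChar_add, smul_mul_smul_comm]

theorem HasFunctionModel.zero {p q : ℕ} : HasFunctionModel (0 : Idx p q → ℤ) := by
  have h : IsWeightVector (rightRegular (KGroup p q)) 0 1 := fun t => by
    simp only [torusChar, Pi.zero_apply, zpow_zero, Finset.prod_const_one, one_smul]
    rfl
  refine ⟨{1}, 1, Set.finite_singleton _, ?_, ?_, rfl, rfl, h, ?_⟩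
  · rintro f rfl
    exact continuous_const
  · rintro g f rfl
    exact Submodule.subset_span rfl
  · rintro f rfl _
    exact ⟨0, h, by simpa using IsPosSum.zero, fun _ => Submodule.subset_span rfl⟩

-- Cartan product: weights add under multiplication of functions. As the cone of positive sums is
-- pointed, a product reaches the top weight only if both factors do, so the top weight functions
-- still form a line.
open scoped Pointwise in
theorem HasFunctionModel.add {p q : ℕ} {μ μ' : Idx p q → ℤ} (h : HasFunctionModel μ)
    (h' : HasFunctionModel μ') : HasFunctionModel (μ + μ') := by
  obtain ⟨S, v, hfin, hcont, hst, hvS, hv1, hv, hS⟩ := h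
  obtain ⟨S', v', hfin', hcont', hst', hvS', hv1', hv', hS'⟩ := h'
  refine ⟨S * S', v * v', hfin.mul hfin', ?_, ?_, Set.mul_mem_mul hvS hvS',
    by simp [hv1, hv1'], hv.mul hv', ?_⟩
  · rintro _ ⟨f, hf, f', hf', rfl⟩
    exact (hcont f hf).mul (hcont' f' hf')
  · rintro g _ ⟨f, hf, f', hf', rfl⟩
    change rightRegular _ g (f * f') ∈ _
    rw [rightRegular_mul, ← Submodule.span_mul_span]
    exact Submodule.mul_mem_mul (hst g f hf) (hst' g f' hf')
  · rintro _ ⟨f, hf, f', hf', rfl⟩ h0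
    change f * f' ≠ 0 at h0
    obtain ⟨ν, hν, hle, heq⟩ := hS f hf (left_ne_zero_of_mul h0)
    obtain ⟨ν', hν', hle', heq'⟩ := hS' f' hf' (right_ne_zero_of_mul h0)
    refine ⟨ν + ν', hν.mul hν', ?_, fun hsum => ?_⟩
    · rw [add_sub_add_comm]
      exact hle.add hle'
    · have hz : (μ - ν) + (μ' - ν') = 0 := by rw [← add_sub_add_comm, hsum, sub_self]
      have h1 := hle.eq_zero_of_add hle' hz
      have h2 : μ' - ν' = 0 := by rwa [h1, zero_add] at hz
      obtain ⟨c, rfl⟩ := Submodule.mem_span_singleton.mp (heq (sub_eq_zero.mp h1).symm)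
      obtain ⟨c', rfl⟩ := Submodule.mem_span_singleton.mp (heq' (sub_eq_zero.mp h2).symm)
      exact Submodule.mem_span_singleton.mpr ⟨c * c', (smul_mul_smul_comm _ _ _ _).symm⟩

theorem HasFunctionModel.nsmul {p q : ℕ} {μ : Idx p q → ℤ} (h : HasFunctionModel μ) (n : ℕ) :
    HasFunctionModel (n • μ) := by
  induction n with
  | zero => rw [zero_smul]; exact .zero
  | succ n ih => rw [succ_nsmul]; exact ih.add h

theorem IsPosSum.root {p q : ℕ} {a b : Idx p q} (h : CompactPosRoot a b) :
    IsPosSum (Pi.single a 1 - Pi.single b 1 : Idx p q → ℤ) := by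
  refine ⟨fun a' b' => if a' = a ∧ b' = b then 1 else 0, fun a' b' h' => ?_, ?_⟩
  · have : a' = a ∧ b' = b := by by_contra hn; simp [hn] at h'
    rwa [this.1, this.2]
  · rw [Finset.sum_eq_single a, Finset.sum_eq_single b]
    · simp
    · intro b' _ hb; simp [hb]
    · simp
    · intro a' _ ha; simp [ha]
    · simp

theorem IsPosSum.sum {p q : ℕ} {ι : Type*} (s : Finset ι) {x : ι → Idx p q → ℤ}
    (h : ∀ i ∈ s, IsPosSum (x i)) : IsPosSum (∑ i ∈ s, x i) :=
  Finset.sum_induction x IsPosSum (fun _ _ => .add) .zero h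

theorem torusChar_sum_single {ι κ : Type*} [Fintype ι] [DecidableEq ι] [Fintype κ] (d : κ → ι)
    (t : ι → Circle) :
    torusChar (∑ j, Pi.single (d j) 1 : ι → ℤ) t = ∏ j, (t (d j) : ℂ) := by
  have h1 : ∀ a, torusChar (Pi.single a 1 : ι → ℤ) t = t a := fun a => by
    rw [torusChar, Finset.prod_eq_single a]
    · simp
    · intro b _ hb; simp [Pi.single_eq_of_ne hb]
    · simp
  have h0 : torusChar (0 : ι → ℤ) t = 1 := by simp [torusChar]
  have : ∀ s : Finset κ, torusChar (∑ j ∈ s, Pi.single (d j) 1 : ι → ℤ) t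
      = ∏ j ∈ s, (t (d j) : ℂ) := by
    classical
    intro s
    induction s using Finset.induction_on with
    | empty => simpa using h0
    | insert a s ha ih => rw [Finset.sum_insert ha, Finset.prod_insert ha, torusChar_add, h1, ih]
  exact this Finset.univ

/-! ### Minors, inverse determinants and dominant weights -/

/-- A homomorphism `K → U(n)` onto one of the factors, with the corresponding coordinates. -/
structure FactorData (p q n : ℕ) where
  proj : KGroup p q →* Matrix.unitaryGroup (Fin n) ℂ
  idx : Fin n → Idx p q
  continuous_proj : Continuous proj
  idx_injective : Function.Injective idx
  root : ∀ a b, a < b → CompactPosRoot (idx a) (idx b)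
  proj_torus : ∀ t, proj (torus p q t) = diagU n fun i => t (idx i)

/-- The minor with the first `k` rows and the columns `c`. -/
def FactorData.minor {p q n : ℕ} (D : FactorData p q n) {k : ℕ} (hk : k ≤ n) (c : Fin k → Fin n) :
    KGroup p q → ℂ := fun x =>
  Matrix.det (Matrix.of fun j i => (D.proj x : Matrix (Fin n) (Fin n) ℂ) (Fin.castLE hk i) (c j))

theorem FactorData.continuous_minor {p q n : ℕ} (D : FactorData p q n) {k : ℕ} (hk : k ≤ n)
    (c : Fin k → Fin n) : Continuous (D.minor hk c) := by
  refine Continuous.matrix_det (continuous_matrix fun j i => ?_)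
  exact (continuous_subtype_val.comp D.continuous_proj).matrix_elem _ _

/-- This is multilinear expansion of the determinant in its chosen columns. The sum runs over all
maps `r`, injective or not, so no ordering of column sets is needed. -/
theorem FactorData.minor_mul {p q n : ℕ} (D : FactorData p q n) {k : ℕ} (hk : k ≤ n)
    (c : Fin k → Fin n) (x g : KGroup p q) :
    D.minor hk c (x * g) = ∑ r : Fin k → Fin n,
      (∏ j, (D.proj g : Matrix (Fin n) (Fin n) ℂ) (r j) (c j)) * D.minor hk r x := by
  have h : (fun j i => (D.proj (x * g) : Matrix (Fin n) (Fin n) ℂ) (Fin.castLE hk i) (c j)) =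
      fun j => ∑ a, (D.proj g : Matrix (Fin n) (Fin n) ℂ) a (c j) •
        fun i => (D.proj x : Matrix (Fin n) (Fin n) ℂ) (Fin.castLE hk i) a := by
    funext j i
    simp [Matrix.mul_apply, mul_comm]
  have h2 := (Matrix.detRowAlternating (R := ℂ) (n := Fin k)).toMultilinearMap.map_sum
    (fun j a => (D.proj g : Matrix (Fin n) (Fin n) ℂ) a (c j) •
        fun i => (D.proj x : Matrix (Fin n) (Fin n) ℂ) (Fin.castLE hk i) a)
  refine (congrArg (fun M => Matrix.det (Matrix.of M)) h).trans (h2.trans ?_)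
  refine Finset.sum_congr rfl fun r _ => ?_
  exact (Matrix.detRowAlternating (R := ℂ) (n := Fin k)).toMultilinearMap.map_smul_univ _ _

theorem FactorData.isWeightVector_minor {p q n : ℕ} (D : FactorData p q n) {k : ℕ} (hk : k ≤ n)
    (c : Fin k → Fin n) :
    IsWeightVector (rightRegular _) (∑ j, Pi.single (D.idx (c j)) 1) (D.minor hk c) := by
  intro t
  funext x
  rw [rightRegular_apply, torusChar_sum_single, Pi.smul_apply, smul_eq_mul, FactorData.minor,
    FactorData.minor, ← Matrix.det_mul_column]
  congr 1
  ext j i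
  simp [D.proj_torus, coe_diagU, Matrix.mul_diagonal, mul_comm]

theorem FactorData.injective_of_minor_ne_zero {p q n : ℕ} (D : FactorData p q n) {k : ℕ}
    (hk : k ≤ n) (c : Fin k → Fin n) (h : D.minor hk c ≠ 0) : Function.Injective c := by
  intro a b hab
  by_contra hne
  refine h (funext fun x => Matrix.det_zero_of_row_eq hne ?_)
  funext i
  simp [hab]

theorem sum_single_eq_sum_image {p q n k : ℕ} (e : Fin n → Idx p q) {c : Fin k → Fin n}
    (hc : Function.Injective c) :
    (∑ j, Pi.single (e (c j)) 1 : Idx p q → ℤ) =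
      ∑ a ∈ Finset.univ.image c, Pi.single (e a) 1 := by
  rw [Finset.sum_image hc.injOn]

/-- The weight depends only on the set of columns. Once this set is listed in increasing order its
`j`-th element is at least `j`, so the difference splits into terms that are zero or a positive
root. -/
theorem FactorData.isPosSum {p q n : ℕ} (D : FactorData p q n) {k : ℕ} (hk : k ≤ n)
    {c : Fin k → Fin n} (hc : Function.Injective c) :
    IsPosSum ((∑ j : Fin k, Pi.single (D.idx (Fin.castLE hk j)) 1 : Idx p q → ℤ) -
      ∑ j, Pi.single (D.idx (c j)) 1) := by
  have hcard : (Finset.univ.image c).card = k := by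
    rw [Finset.card_image_of_injective _ hc, Finset.card_fin]
  let c' := (Finset.univ.image c).orderEmbOfFin hcard
  have h1 : (∑ j, Pi.single (D.idx (c j)) 1 : Idx p q → ℤ) =
      ∑ j, Pi.single (D.idx (c' j)) 1 := by
    rw [sum_single_eq_sum_image D.idx hc, sum_single_eq_sum_image D.idx c'.injective]
    congr 1
    rw [← Finset.coe_inj]
    refine (Finset.range_orderEmbOfFin _ hcard).symm.trans ?_
    simp [c']
  rw [h1, ← Finset.sum_sub_distrib]
  refine .sum _ fun j _ => ?_
  have hle : ∀ i (hi : i < k), i ≤ (c' ⟨i, hi⟩ : ℕ) := by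
    intro i
    induction i with
    | zero => intro _; exact Nat.zero_le _
    | succ i ih =>
      intro hi
      have h2 : c' ⟨i, by omega⟩ < c' ⟨i + 1, hi⟩ := c'.strictMono (by simp)
      have h3 := ih (by omega)
      have h4 : (c' ⟨i, by omega⟩ : ℕ) < c' ⟨i + 1, hi⟩ := h2
      omega
  rcases (show Fin.castLE hk j ≤ c' j from hle j j.2).eq_or_lt with h | h
  · rw [h, sub_self]; exact .zero
  · exact .root (D.root _ _ h)

/-- The weight determines the set of columns, so `c` permutes the first `k` columns and the minor is
the leading one up to sign. -/
theorem FactorData.minor_mem_span {p q n : ℕ} (D : FactorData p q n) {k : ℕ} (hk : k ≤ n)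
    {c : Fin k → Fin n} (hc : Function.Injective c)
    (h : (∑ j, Pi.single (D.idx (c j)) 1 : Idx p q → ℤ) =
      ∑ j : Fin k, Pi.single (D.idx (Fin.castLE hk j)) 1) :
    D.minor hk c ∈ Submodule.span ℂ {D.minor hk (Fin.castLE hk)} := by
  have hmem : ∀ j, ∃ i, Fin.castLE hk i = c j := by
    intro j
    by_contra! hne
    have h1 := congrFun h (D.idx (c j))
    rw [Finset.sum_apply, Finset.sum_apply, Finset.sum_eq_single j,
      Finset.sum_eq_zero (s := Finset.univ) (f := fun i : Fin k => Pi.single (M := fun _ => ℤ)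
        (D.idx (Fin.castLE hk i)) 1 (D.idx (c j)))] at h1
    · simp at h1
    · intro i _
      exact Pi.single_eq_of_ne (fun h => hne i (D.idx_injective h.symm)) _
    · intro i _ hi
      exact Pi.single_eq_of_ne (fun h => hi (hc (D.idx_injective h.symm))) _
    · simp
  choose τ hτ using hmem
  have hτi : Function.Injective τ := fun a b hab => hc (by rw [← hτ, ← hτ, hab])
  let τ' : Equiv.Perm (Fin k) := Equiv.ofBijective τ (Finite.injective_iff_bijective.mp hτi)
  refine Submodule.mem_span_singleton.mpr ⟨((Equiv.Perm.sign τ' : ℤ) : ℂ), ?_⟩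
  funext x
  rw [Pi.smul_apply, smul_eq_mul, FactorData.minor, FactorData.minor, ← Matrix.det_permute]
  congr 1
  ext j i
  simp [τ', hτ]

/-- The fundamental weights are realized by the `k`-minors on the first `k` rows; the leading minor
is 1 at the identity. -/
theorem FactorData.hasFunctionModel_sum_single {p q n : ℕ} (D : FactorData p q n) {k : ℕ}
    (hk : k ≤ n) :
    HasFunctionModel (∑ j : Fin k, Pi.single (D.idx (Fin.castLE hk j)) 1 : Idx p q → ℤ) := by
  refine ⟨Set.range (D.minor hk), D.minor hk (Fin.castLE hk), Set.finite_range _, ?_, ?_,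
    ⟨_, rfl⟩, ?_, D.isWeightVector_minor hk _, ?_⟩
  · rintro _ ⟨c, rfl⟩
    exact D.continuous_minor hk c
  · rintro g _ ⟨c, rfl⟩
    have : rightRegular _ g (D.minor hk c) = ∑ r : Fin k → Fin n,
        (∏ j, (D.proj g : Matrix (Fin n) (Fin n) ℂ) (r j) (c j)) • D.minor hk r := by
      funext x
      rw [rightRegular_apply, D.minor_mul]
      simp
    rw [this]
    exact Submodule.sum_mem _ fun r _ => Submodule.smul_mem _ _ (Submodule.subset_span ⟨r, rfl⟩)
  · rw [FactorData.minor, map_one, ← Matrix.det_one (n := Fin k)]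
    congr 1
    ext j i
    simp [Matrix.one_apply, eq_comm]
  · rintro _ ⟨c, rfl⟩ h0
    have hc := D.injective_of_minor_ne_zero hk c h0
    exact ⟨_, D.isWeightVector_minor hk c, D.isPosSum hk hc, D.minor_mem_span hk hc⟩

theorem FactorData.hasFunctionModel_neg {p q n : ℕ} (D : FactorData p q n) :
    HasFunctionModel (-∑ j, Pi.single (D.idx j) 1 : Idx p q → ℤ) := by
  let f : KGroup p q → ℂ := fun x => (D.proj x : Matrix (Fin n) (Fin n) ℂ).det⁻¹
  have hdet : ∀ g : Matrix.unitaryGroup (Fin n) ℂ, (g : Matrix (Fin n) (Fin n) ℂ).det ≠ 0 :=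
    fun g h => by
      have := congrArg Matrix.det (Matrix.mem_unitaryGroup_iff.mp g.2)
      rw [Matrix.det_mul, h, zero_mul, Matrix.det_one] at this
      exact zero_ne_one this
  have hmul : ∀ g, rightRegular _ g f = (D.proj g : Matrix (Fin n) (Fin n) ℂ).det⁻¹ • f := by
    intro g
    funext x
    change (D.proj (x * g) : Matrix (Fin n) (Fin n) ℂ).det⁻¹ =
      (D.proj g : Matrix (Fin n) (Fin n) ℂ).det⁻¹ * (D.proj x : Matrix (Fin n) (Fin n) ℂ).det⁻¹
    rw [map_mul, Submonoid.coe_mul, Matrix.det_mul, mul_inv, mul_comm]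
  have hw : IsWeightVector (rightRegular _) (-∑ j, Pi.single (D.idx j) 1) f := by
    intro t
    rw [hmul, D.proj_torus, coe_diagU, Matrix.det_diagonal, ← torusChar_sum_single]
    congr 1
    have := torusChar_add (∑ j, Pi.single (D.idx j) 1) (-∑ j, Pi.single (D.idx j) 1) t
    rw [add_neg_cancel, show torusChar (0 : Idx p q → ℤ) t = 1 by simp [torusChar]] at this
    exact inv_eq_of_mul_eq_one_right this.symm
  refine ⟨{f}, f, Set.finite_singleton _, ?_, ?_, rfl, by simp [f], hw, ?_⟩
  · rintro _ rfl
    exact (Continuous.matrix_det (continuous_subtype_val.comp D.continuous_proj)).inv₀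
      fun x => hdet _
  · rintro g _ rfl
    rw [hmul]
    exact Submodule.smul_mem _ _ (Submodule.subset_span rfl)
  · rintro _ rfl _
    exact ⟨_, hw, by rw [sub_self]; exact .zero, fun _ => Submodule.subset_span rfl⟩

/-- A dominant weight is a nonnegative combination of fundamental weights and of the weight of the
inverse determinant. -/
theorem FactorData.hasFunctionModel_of_antitone {p q n : ℕ} (D : FactorData p q n) (a : Fin n → ℤ)
    (ha : Antitone a) : HasFunctionModel (∑ i, Pi.single (D.idx i) (a i) : Idx p q → ℤ) := by
  have key : ∀ k ≤ n, ∀ a : Fin n → ℤ, Antitone a → (∀ i, 0 ≤ a i) →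
      (∀ i : Fin n, k ≤ i → a i = 0) →
      HasFunctionModel (∑ i, Pi.single (D.idx i) (a i) : Idx p q → ℤ) := by
    intro k
    induction k with
    | zero =>
      intro _ a _ _ h0
      have : (∑ i, Pi.single (D.idx i) (a i) : Idx p q → ℤ) = 0 :=
        Finset.sum_eq_zero fun i _ => by rw [h0 i (Nat.zero_le _), Pi.single_zero]
      rw [this]
      exact .zero
    | succ k ih =>
      intro hk a ha hpos h0
      let k' : Fin n := ⟨k, hk⟩
      obtain ⟨N, hN⟩ := Int.eq_ofNat_of_zero_le (hpos k')
      -- Subtracting the last possibly nonzero entry from the first `k + 1` entries removes that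
      -- many copies of a fundamental weight and shortens the support.
      let b : Fin n → ℤ := fun i => if i ≤ k' then a i - N else 0
      have hb := ih (by omega) b (by
        intro i j hij
        simp only [b]
        have h1 := ha hij
        by_cases hj : j ≤ k'
        · rw [if_pos hj, if_pos (hij.trans hj)]; omega
        · rw [if_neg hj]
          split_ifs with hi
          · have := ha hi
            omega
          · exact le_rfl) (by
        intro i
        simp only [b]
        split_ifs with hi
        · have := ha hi
          omega
        · exact le_rfl) (by
        intro i hi
        simp only [b]
        split_ifs with hi'
        · have : i = k' := le_antisymm hi' hi
          rw [this, hN]; exact sub_self _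
        · rfl)
      have hsum : (∑ i, Pi.single (D.idx i) (a i) : Idx p q → ℤ) =
          (∑ i, Pi.single (D.idx i) (b i)) +
            N • ∑ j : Fin (k + 1), Pi.single (D.idx (Fin.castLE hk j)) 1 := by
        have h1 : (∑ j : Fin (k + 1), Pi.single (D.idx (Fin.castLE hk j)) 1 : Idx p q → ℤ) =
            ∑ i : Fin n, if i ≤ k' then Pi.single (D.idx i) 1 else 0 := by
          rw [← Finset.sum_filter]
          refine Finset.sum_bij (fun j _ => Fin.castLE hk j) ?_ ?_ ?_ ?_
          · intro j _
            simpa [k', Fin.le_def] using Nat.lt_succ_iff.mp j.2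
          · intro i _ j _ h
            exact Fin.castLE_injective hk h
          · intro i hi
            have hi' : i ≤ k' := (Finset.mem_filter.mp hi).2
            exact ⟨⟨i, Nat.lt_succ_iff.mpr hi'⟩, Finset.mem_univ _, rfl⟩
          · intro j _
            rfl
        rw [h1, Finset.smul_sum, ← Finset.sum_add_distrib]
        refine Finset.sum_congr rfl fun i _ => ?_
        simp only [b]
        split_ifs with hi
        · rw [← Pi.single_smul, ← Pi.single_add]
          simp
        · have : a i = 0 := h0 i (Nat.succ_le_of_lt (not_le.mp hi))
          simp [this]
      rw [hsum]
      exact hb.add ((D.hasFunctionModel_sum_single hk).nsmul N)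
  -- A shift by `c` makes all entries nonnegative; `c` copies of the inverse determinant undo it.
  let c : ℤ := ∑ i, |a i|
  have hc0 : 0 ≤ c := Finset.sum_nonneg fun i _ => abs_nonneg _
  obtain ⟨N, hN⟩ := Int.eq_ofNat_of_zero_le hc0
  have hsum : (∑ i, Pi.single (D.idx i) (a i) : Idx p q → ℤ) =
      (∑ i, Pi.single (D.idx i) (a i + c)) + N • -∑ j, Pi.single (D.idx j) 1 := by
    rw [smul_neg, Finset.smul_sum, ← sub_eq_add_neg, ← Finset.sum_sub_distrib]
    refine Finset.sum_congr rfl fun i _ => ?_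
    rw [← Pi.single_smul, ← Pi.single_sub, hN]
    simp
  rw [hsum]
  refine (key n le_rfl (fun i => a i + c) (fun i j h => add_le_add (ha h) le_rfl)
    (fun i => ?_) (fun i hi => absurd i.2 (not_lt.mpr hi))).add (D.hasFunctionModel_neg.nsmul N)
  have h1 : |a i| ≤ c := Finset.single_le_sum (f := fun i => |a i|) (fun i _ => abs_nonneg _)
    (Finset.mem_univ i)
  have := neg_abs_le (a i)
  omega

/-- Every dominant weight has a function model. -/
theorem hasFunctionModel_of_dominant {p q : ℕ} (μ : Idx p q → ℤ)
    (h1 : Antitone fun i => μ (.inl i)) (h2 : Antitone fun j => μ (.inr j)) :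
    HasFunctionModel μ := by
  let D1 : FactorData p q p := ⟨MonoidHom.fst _ _, Sum.inl, continuous_fst, Sum.inl_injective,
    fun _ _ h => h, fun _ => rfl⟩
  let D2 : FactorData p q q := ⟨MonoidHom.snd _ _, Sum.inr, continuous_snd, Sum.inr_injective,
    fun _ _ h => h, fun _ => rfl⟩
  have := (D1.hasFunctionModel_of_antitone _ h1).add (D2.hasFunctionModel_of_antitone _ h2)
  have hμ : μ = (∑ i, Pi.single (D1.idx i) (μ (.inl i))) +
      ∑ j, Pi.single (D2.idx j) (μ (.inr j)) := by
    conv_lhs => rw [← Finset.univ_sum_single μ, Fintype.sum_sum_type]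
  rw [hμ]
  exact this

/-! ### Cyclic representations -/

/-- The subrepresentation generated by a vector. -/
def cyclic {G X : Type*} [Group G] [AddCommGroup X] [Module ℂ X] (ρ : Representation ℂ G X)
    (v : X) : Subrepresentation ρ where
  toSubmodule := Submodule.span ℂ (Set.range fun g => ρ g v)
  apply_mem_toSubmodule g x hx := by
    have : Submodule.span ℂ (Set.range fun g => ρ g v) ≤
        (Submodule.span ℂ (Set.range fun g => ρ g v)).comap (ρ g) := by
      rw [Submodule.span_le]
      rintro _ ⟨h, rfl⟩
      refine Submodule.subset_span ⟨g * h, ?_⟩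
      simp only [map_mul, Module.End.mul_apply]
    exact this hx

theorem mem_cyclic {G X : Type*} [Group G] [AddCommGroup X] [Module ℂ X]
    (ρ : Representation ℂ G X) (v : X) : v ∈ (cyclic ρ v).toSubmodule :=
  Submodule.subset_span ⟨1, by simp only [map_one, Module.End.one_apply]⟩

theorem cyclic_le {G X : Type*} [Group G] [AddCommGroup X] [Module ℂ X]
    {ρ : Representation ℂ G X} {v : X} {N : Submodule ℂ X} (hN : ∀ g, ∀ x ∈ N, ρ g x ∈ N)
    (hv : v ∈ N) : (cyclic ρ v).toSubmodule ≤ N := by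
  refine Submodule.span_le.mpr ?_
  rintro _ ⟨g, rfl⟩
  exact hN g v hv

/-- A cyclic representation whose generator is an eigenvector of all its equivariant endomorphisms
is irreducible. -/
theorem isIrreducible_cyclic {G X : Type*} [Group G] [TopologicalSpace G]
    [IsTopologicalGroup G] [CompactSpace G] [AddCommGroup X] [Module ℂ X]
    (ρ : Representation ℂ G X) (v : X) (hv : v ≠ 0)
    [FiniteDimensional ℂ (cyclic ρ v).toSubmodule]
    (hcont : CoeffContinuous (cyclic ρ v).toRepresentation)
    (h : ∀ P : (cyclic ρ v).toSubmodule →ₗ[ℂ] (cyclic ρ v).toSubmodule,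
      (∀ g x, P ((cyclic ρ v).toRepresentation g x) = (cyclic ρ v).toRepresentation g (P x)) →
      (P ⟨v, mem_cyclic ρ v⟩ : X) ∈ Submodule.span ℂ {v}) :
    (cyclic ρ v).toRepresentation.IsIrreducible := by
  let w : (cyclic ρ v).toSubmodule := ⟨v, mem_cyclic ρ v⟩
  have : Nontrivial (cyclic ρ v).toSubmodule :=
    ⟨⟨w, 0, fun h => hv (congrArg Subtype.val h)⟩⟩
  have hgen : ∀ N : Submodule ℂ (cyclic ρ v).toSubmodule,
      (∀ g, ∀ x ∈ N, (cyclic ρ v).toRepresentation g x ∈ N) → w ∈ N → N = ⊤ := by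
    intro N hN hw
    have hle : (cyclic ρ v).toSubmodule ≤ N.map (cyclic ρ v).toSubmodule.subtype := by
      refine cyclic_le ?_ ⟨w, hw, rfl⟩
      rintro g _ ⟨x, hx, rfl⟩
      exact ⟨_, hN g x hx, rfl⟩
    refine Submodule.eq_top_iff'.mpr fun x => ?_
    obtain ⟨y, hy, hyx⟩ := hle x.2
    rwa [← Subtype.ext hyx]
  refine isIrreducible_of_submodule _ fun N hN => ?_
  -- The projection onto `N` multiplies the generator by a scalar `c`. If `c` is 0 the projection
  -- vanishes identically and `N` is zero; otherwise the generator lies in `N`.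
  obtain ⟨P, hP1, hP2, hP3⟩ := exists_equivariant_projection _ hcont N hN
  obtain ⟨c, hc⟩ := Submodule.mem_span_singleton.mp (h P hP3)
  have hc' : P w = c • w := Subtype.ext hc.symm
  by_cases hc0 : c = 0
  · left
    have hker := hgen (LinearMap.ker P) (fun g x hx => by
      rw [LinearMap.mem_ker] at hx ⊢
      rw [hP3, hx, map_zero]) (by rw [LinearMap.mem_ker, hc', hc0, zero_smul])
    refine (Submodule.eq_bot_iff N).mpr fun x hx => ?_
    rw [← hP2 x hx]
    exact LinearMap.mem_ker.mp (hker ▸ Submodule.mem_top)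
  · right
    refine hgen N hN ?_
    have : w = c⁻¹ • P w := by rw [hc', smul_smul, inv_mul_cancel₀ hc0, one_smul]
    rw [this]
    exact N.smul_mem _ (hP1 w)

theorem CoeffContinuous.subrepresentation {G V : Type*} [Group G] [TopologicalSpace G]
    [AddCommGroup V] [Module ℂ V] {σ : Representation ℂ G V} (hσ : CoeffContinuous σ)
    (N : Subrepresentation σ) : CoeffContinuous N.toRepresentation := by
  intro v φ
  obtain ⟨ψ, hψ⟩ := φ.exists_extend
  have : ∀ k, φ (N.toRepresentation k v) = ψ (σ k v) := fun k => by
    rw [← hψ]; rfl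
  simp only [this]
  exact hσ v ψ

/-- The functionals on a finite-dimensional space of functions are combinations of evaluations. -/
theorem span_evaluations_eq_top {X : Type*} (U : Submodule ℂ (X → ℂ)) [FiniteDimensional ℂ U] :
    Submodule.span ℂ (Set.range fun x : X => (LinearMap.proj x ∘ₗ U.subtype : Module.Dual ℂ U)) =
      ⊤ := by
  rw [← Subspace.dualCoannihilator_dualAnnihilator_eq (W := Submodule.span ℂ _)]
  have : (Submodule.span ℂ (Set.range fun x : X =>
      (LinearMap.proj x ∘ₗ U.subtype : Module.Dual ℂ U))).dualCoannihilator = ⊥ := by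
    refine (Submodule.eq_bot_iff _).mpr fun u hu => Subtype.ext (funext fun x => ?_)
    exact (Submodule.mem_dualCoannihilator u).mp hu _ (Submodule.subset_span ⟨x, rfl⟩)
  rw [this, Submodule.dualAnnihilator_bot]

/-- The coefficient of `u` against evaluation at `x` sends `k` to `u (x * k)`, which is continuous,
and evaluations span the dual. -/
theorem coeffContinuous_of_continuous {G : Type*} [Group G] [TopologicalSpace G]
    [IsTopologicalGroup G] (U : Subrepresentation (rightRegular G))
    [FiniteDimensional ℂ U.toSubmodule] (hU : ∀ f ∈ U.toSubmodule, Continuous f) :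
    CoeffContinuous U.toRepresentation := by
  intro u φ
  have hφ : φ ∈ Submodule.span ℂ (Set.range fun x : G =>
      (LinearMap.proj x ∘ₗ U.toSubmodule.subtype : Module.Dual ℂ U.toSubmodule)) := by
    rw [span_evaluations_eq_top]; trivial
  induction hφ using Submodule.span_induction with
  | mem φ h =>
    obtain ⟨x, rfl⟩ := h
    exact (hU u u.2).comp (continuous_const.mul continuous_id)
  | zero => exact continuous_const
  | add φ ψ _ _ h h' => exact h.add h'
  | smul c φ _ h => exact h.const_smul c

/-! ### Weight vectors in a function model -/

/-- Joint generalized eigenspaces of a commuting family are independent, and different weights give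
different characters. -/
theorem iSupIndep_weightSpace {p q : ℕ} {V : Type*} [AddCommGroup V] [Module ℂ V]
    (σ : Representation ℂ (KGroup p q) V) :
    iSupIndep fun ν : Idx p q → ℤ =>
      ⨅ t, Module.End.eigenspace (σ (torus p q t)) (torusChar ν t) := by
  have h := Module.End.independent_iInf_maxGenEigenspace_of_forall_mapsTo
    (fun t => (σ (torus p q t) : Module.End ℂ V)) fun s t φ =>
      Module.End.mapsTo_maxGenEigenspace_of_comm (by
        change σ _ * σ _ = σ _ * σ _
        rw [← map_mul, ← map_mul, ← map_mul, ← map_mul, mul_comm]) φ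
  have h2 := h.comp (f := fun ν : Idx p q → ℤ => torusChar ν)
    fun ν ν' hν => torusChar_injective (congrFun hν)
  refine h2.mono fun ν => iInf_mono fun t => ?_
  exact Module.End.eigenspace_le_maxGenEigenspace

theorem mem_weightSpace {p q : ℕ} {V : Type*} [AddCommGroup V] [Module ℂ V]
    {σ : Representation ℂ (KGroup p q) V} {ν : Idx p q → ℤ} {x : V} :
    x ∈ ⨅ t, Module.End.eigenspace (σ (torus p q t)) (torusChar ν t) ↔ IsWeightVector σ ν x := by
  simp [IsWeightVector]

/-- A weight vector in the span of weight vectors is in the span of those of the same weight. -/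
theorem IsWeightVector.mem_span {p q : ℕ} {V : Type*} [AddCommGroup V] [Module ℂ V]
    {σ : Representation ℂ (KGroup p q) V} {S : Set V}
    (hS : ∀ f ∈ S, f ≠ 0 → ∃ ν, IsWeightVector σ ν f) {ν : Idx p q → ℤ} {x : V}
    (hx : IsWeightVector σ ν x) (hxS : x ∈ Submodule.span ℂ S) :
    x ∈ Submodule.span ℂ {f ∈ S | f ≠ 0 ∧ IsWeightVector σ ν f} := by
  set E := fun ν : Idx p q → ℤ =>
    ⨅ t, Module.End.eigenspace (σ (torus p q t)) (torusChar ν t) with hE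
  -- The spanning vectors are sorted into those of weight `ν` and the rest; independence of weight
  -- spaces makes the second component of `x` vanish.
  have hle : Submodule.span ℂ S ≤ Submodule.span ℂ {f ∈ S | f ≠ 0 ∧ IsWeightVector σ ν f} ⊔
      ⨆ ν' ≠ ν, E ν' := by
    refine Submodule.span_le.mpr fun f hf => ?_
    by_cases h0 : f = 0
    · rw [h0]; exact Submodule.zero_mem _
    by_cases hν : IsWeightVector σ ν f
    · exact Submodule.mem_sup_left (Submodule.subset_span ⟨hf, h0, hν⟩)
    · obtain ⟨ν', hν'⟩ := hS f hf h0
      refine Submodule.mem_sup_right (Submodule.mem_iSup_of_mem ν' (Submodule.mem_iSup_of_mem ?_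
        (mem_weightSpace.mpr hν')))
      rintro rfl
      exact hν hν'
  obtain ⟨y, hy, z, hz, rfl⟩ := Submodule.mem_sup.mp (hle hxS)
  have hyE : y ∈ E ν := by
    refine (Submodule.span_le.mpr ?_ : Submodule.span ℂ _ ≤ E ν) hy
    rintro f ⟨_, _, hf⟩
    exact mem_weightSpace.mpr hf
  have hzE : z ∈ E ν := by
    have := (E ν).sub_mem (mem_weightSpace.mpr hx) hyE
    rwa [add_sub_cancel_left] at this
  have hz0 : z = 0 := by
    have := (iSupIndep_weightSpace σ ν).le_bot ⟨hzE, hz⟩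
    simpa using this
  rwa [hz0, add_zero]

/-! ### Restriction to `K'` -/

/-- The coordinates of the torus of `U(m,q)` among those of the torus of `U(m+1,q)`. -/
def idxEmb (m q : ℕ) : Idx m q → Idx (m + 1) q := Sum.map Fin.castSucc id

theorem sum_idx_succ {M : Type*} [AddCommMonoid M] {m q : ℕ} (F : Idx (m + 1) q → M) :
    ∑ a, F a = ∑ a, F (idxEmb m q a) + F (.inl (Fin.last m)) := by
  rw [Fintype.sum_sum_type, Fintype.sum_sum_type, Fin.sum_univ_castSucc]
  simp only [idxEmb, Sum.map_inl, Sum.map_inr, id]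
  abel

theorem prod_idx_succ {M : Type*} [CommMonoid M] {m q : ℕ} (F : Idx (m + 1) q → M) :
    ∏ a, F a = (∏ a, F (idxEmb m q a)) * F (.inl (Fin.last m)) := by
  rw [Fintype.prod_sum_type, Fintype.prod_sum_type, Fin.prod_univ_castSucc]
  simp only [idxEmb, Sum.map_inl, Sum.map_inr, id]
  exact mul_right_comm _ _ _

theorem idxEmb_injective (m q : ℕ) : Function.Injective (idxEmb m q) :=
  Sum.map_injective.mpr ⟨Fin.castSucc_injective m, Function.injective_id⟩

/-- A sum of compact positive roots of `K` in which the last coordinate of `U(m+1)` does not occur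
is a sum of compact positive roots of `K'`. -/
theorem IsPosSum.comp_idxEmb {m q : ℕ} {x : Idx (m + 1) q → ℤ} (hx : IsPosSum x)
    (h0 : x (.inl (Fin.last m)) = 0) : IsPosSum fun a => x (idxEmb m q a) := by
  obtain ⟨c, hc, rfl⟩ := hx
  have hlast : ∀ b, c (.inl (Fin.last m)) b = 0 := by
    intro b
    by_contra h
    have := hc _ _ h
    rcases b with b | b
    · exact absurd this (not_lt.mpr (Fin.le_last b))
    · exact this
  -- No positive root has the last index of `U(m+1)` in first place. That coordinate is then minus a
  -- sum of multiplicities, so its vanishing kills each of them.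
  have hlast' : ∀ a, c a (.inl (Fin.last m)) = 0 := by
    rw [sum_smul_root_apply] at h0
    have h1 : ∀ a, ∑ b, (c a b : ℤ) * ((if Sum.inl (Fin.last m) = a then 1 else 0) -
        if Sum.inl (Fin.last m) = b then 1 else 0) = -c a (.inl (Fin.last m)) := by
      intro a
      by_cases ha : Sum.inl (Fin.last m) = a
      · subst ha; simp [hlast]
      · simp [ha]
    simp only [h1, Finset.sum_neg_distrib, neg_eq_zero] at h0
    intro a
    have := (Finset.sum_eq_zero_iff_of_nonneg fun a _ => Int.natCast_nonneg _).mp h0 a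
      (Finset.mem_univ a)
    exact_mod_cast this
  refine ⟨fun a b => c (idxEmb m q a) (idxEmb m q b), fun a b hab => ?_, ?_⟩
  · have := hc _ _ hab
    rcases a with a | a <;> rcases b with b | b <;> exact this
  · funext d
    rw [sum_smul_root_apply, sum_smul_root_apply, sum_idx_succ]
    simp only [hlast, Nat.cast_zero, zero_mul, Finset.sum_const_zero, add_zero]
    refine Finset.sum_congr rfl fun a _ => ?_
    rw [sum_idx_succ, hlast', Nat.cast_zero, zero_mul, add_zero]
    simp only [(idxEmb_injective m q).eq_iff]

theorem coe_diagU_succ {m : ℕ} (t : Fin (m + 1) → Circle) :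
    (diagU (m + 1) t : Matrix (Fin (m + 1)) (Fin (m + 1)) ℂ) =
      Matrix.reindex finSumFinEquiv finSumFinEquiv (Matrix.fromBlocks
        (Matrix.diagonal fun i : Fin m => (t i.castSucc : ℂ)) 0 0
        (Matrix.diagonal fun _ : Fin 1 => (t (Fin.last m) : ℂ))) := by
  rw [Matrix.fromBlocks_diagonal, Matrix.reindex_apply, coe_diagU,
    Matrix.submatrix_diagonal_equiv]
  congr 1
  funext i
  obtain ⟨j, rfl⟩ := finSumFinEquiv.surjective i
  rcases j with j | j
  · simp [Fin.castSucc]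
  · have : j = 0 := Subsingleton.elim _ _
    subst this
    simp only [Function.comp_apply, Equiv.symm_apply_apply, Sum.elim_inr]
    congr 2

/-- The element of the torus of `K` with entry `z` at the last coordinate of `U(m+1)`. -/
noncomputable def lastCircle (m q : ℕ) (z : Circle) : KGroup (m + 1) q :=
  torus (m + 1) q (Pi.mulSingle (.inl (Fin.last m)) z)

theorem coe_inclU {m : ℕ} (g : Matrix.unitaryGroup (Fin m) ℂ) :
    (inclU m g : Matrix (Fin (m + 1)) (Fin (m + 1)) ℂ) =
      Matrix.reindex finSumFinEquiv finSumFinEquiv (Matrix.fromBlocks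
        (g : Matrix (Fin m) (Fin m) ℂ) 0 0 (1 : Matrix (Fin 1) (Fin 1) ℂ)) := rfl

/-- The circle in the last coordinate of `U(m+1)` centralizes `K'`, and so acts by one scalar on any
`K'`-span of an eigenvector. -/
theorem lastCircle_mul_inclK {m q : ℕ} (z : Circle) (g : KGroup m q) :
    lastCircle m q z * inclK m q g = inclK m q g * lastCircle m q z := by
  have h1 : ∀ i : Fin m,
      Pi.mulSingle (M := fun _ => Circle) (Sum.inl (Fin.last m) : Idx (m + 1) q) z
        (.inl i.castSucc) = 1 := fun i =>
    Pi.mulSingle_eq_of_ne (by simp) _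
  have h2 : (fun j : Fin q => Pi.mulSingle (M := fun _ => Circle)
      (Sum.inl (Fin.last m) : Idx (m + 1) q) z (.inr j)) = 1 := funext fun j =>
    Pi.mulSingle_eq_of_ne (by simp) _
  refine Prod.ext (Subtype.ext ?_) ?_
  · change (diagU (m + 1) _ : Matrix (Fin (m + 1)) (Fin (m + 1)) ℂ) * (inclU m g.1 : Matrix (Fin (m + 1)) (Fin (m + 1)) ℂ) =
      (inclU m g.1 : Matrix (Fin (m + 1)) (Fin (m + 1)) ℂ) * (diagU (m + 1) _ : Matrix (Fin (m + 1)) (Fin (m + 1)) ℂ)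
    rw [coe_diagU_succ, coe_inclU]
    simp only [h1, Matrix.reindex_apply, Matrix.submatrix_mul_equiv, Matrix.fromBlocks_multiply]
    simp
  · change diagU q _ * g.2 = g.2 * diagU q _
    rw [h2, map_one, one_mul, mul_one]

theorem torus_succ {m q : ℕ} (t : Idx (m + 1) q → Circle) :
    torus (m + 1) q t = inclK m q (torus m q fun a => t (idxEmb m q a)) *
      lastCircle m q (t (.inl (Fin.last m))) := by
  have h1 : ∀ i : Fin m,
      Pi.mulSingle (M := fun _ => Circle) (Sum.inl (Fin.last m) : Idx (m + 1) q)
        (t (.inl (Fin.last m))) (.inl i.castSucc) = 1 := fun i =>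
    Pi.mulSingle_eq_of_ne (by simp) _
  have h2 : (fun j : Fin q => Pi.mulSingle (M := fun _ => Circle)
      (Sum.inl (Fin.last m) : Idx (m + 1) q) (t (.inl (Fin.last m))) (.inr j)) = 1 :=
    funext fun j => Pi.mulSingle_eq_of_ne (by simp) _
  refine Prod.ext (Subtype.ext ?_) ?_
  · change (diagU (m + 1) _ : Matrix (Fin (m + 1)) (Fin (m + 1)) ℂ) =
      (inclU m (diagU m _) : Matrix (Fin (m + 1)) (Fin (m + 1)) ℂ) * (diagU (m + 1) _ : Matrix (Fin (m + 1)) (Fin (m + 1)) ℂ)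
    rw [coe_diagU_succ, coe_diagU_succ, coe_inclU, coe_diagU]
    simp only [h1, Matrix.reindex_apply, Matrix.submatrix_mul_equiv, Matrix.fromBlocks_multiply]
    simp [idxEmb]
  · change diagU q _ = diagU q _ * diagU q _
    rw [h2, map_one, mul_one]
    rfl

/-- The irreducible representation with highest weight `μ` contains the one of `K'` whose highest
weight is obtained by omitting the last coordinate of `U(m+1)`. -/
theorem HasFunctionModel.occursInRestriction {m q : ℕ} {μ : Idx (m + 1) q → ℤ}
    (h : HasFunctionModel μ) :
    OccursInRestriction (fun a => (μ a : ℝ)) fun a => (μ (idxEmb m q a) : ℝ) := by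
  obtain ⟨S, v, hfin, hcont, hst, hvS, hv1, hv, hS⟩ := h
  have hv0 : v ≠ 0 := fun h => by rw [h] at hv1; exact zero_ne_one hv1
  let U := cyclic (rightRegular (KGroup (m + 1) q)) v
  let σ := U.toRepresentation
  have hUS : U.toSubmodule ≤ Submodule.span ℂ S := by
    refine cyclic_le (fun g x hx => ?_) (Submodule.subset_span hvS)
    have : Submodule.span ℂ S ≤ (Submodule.span ℂ S).comap (rightRegular _ g) :=
      Submodule.span_le.mpr fun f hf => hst g f hf
    exact this hx
  have : FiniteDimensional ℂ (Submodule.span ℂ S) := FiniteDimensional.span_of_finite ℂ hfin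
  have hUfin : FiniteDimensional ℂ U.toSubmodule := Submodule.finiteDimensional_of_le hUS
  have hUcont : ∀ f ∈ U.toSubmodule, Continuous f := by
    intro f hf
    refine Submodule.span_induction (p := fun f _ => Continuous f) (fun f hf => hcont f hf)
      continuous_const (fun f f' _ _ h h' => h.add h') (fun c f _ h => h.const_smul c) (hUS hf)
  have hσ : CoeffContinuous σ := coeffContinuous_of_continuous U hUcont
  have hcoe : ∀ ν (x : U.toSubmodule), IsWeightVector σ ν x →
      IsWeightVector (rightRegular _) ν (x : KGroup (m + 1) q → ℂ) := fun ν x hx t =>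
    congrArg Subtype.val (hx t)
  have hweight : ∀ ν (x : U.toSubmodule), x ≠ 0 → IsWeightVector σ ν x →
      IsPosSum (μ - ν) := by
    intro ν x hx hxν
    have hmem := (hcoe ν x hxν).mem_span (fun f hf h0 => (hS f hf h0).imp fun _ h => h.1)
      (hUS x.2)
    obtain ⟨f, hf, hf0, hfν⟩ : {f ∈ S | f ≠ 0 ∧ IsWeightVector (rightRegular _) ν f}.Nonempty := by
      by_contra hne
      rw [Set.not_nonempty_iff_eq_empty.mp hne, Submodule.span_empty, Submodule.mem_bot] at hmem
      exact hx (Subtype.ext hmem)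
    obtain ⟨ν', hν', hle, _⟩ := hS f hf hf0
    have : ν = ν' := torusChar_injective fun t => smul_left_injective ℂ hf0
      ((hfν t).symm.trans (hν' t))
    rwa [this]
  -- The top weight space is a line, and equivariant maps preserve it. This is the input for
  -- irreducibility of the span of `v`.
  have hline : ∀ x : U.toSubmodule, IsWeightVector σ μ x →
      (x : KGroup (m + 1) q → ℂ) ∈ Submodule.span ℂ {v} := by
    intro x hx
    have hmem := (hcoe μ x hx).mem_span (fun f hf h0 => (hS f hf h0).imp fun _ h => h.1)
      (hUS x.2)
    refine (Submodule.span_le.mpr ?_) hmem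
    rintro f ⟨hf, hf0, hfμ⟩
    obtain ⟨ν', hν', _, heq⟩ := hS f hf hf0
    refine heq (torusChar_injective fun t => smul_left_injective ℂ hf0 ?_)
    exact (hν' t).symm.trans (hfμ t)
  let w : U.toSubmodule := ⟨v, mem_cyclic _ v⟩
  have hw0 : w ≠ 0 := fun h => hv0 (congrArg Subtype.val h)
  have hw : IsWeightVector σ μ w := fun t => Subtype.ext (hv t)
  have hirr : IsIrrepWithHighestWeight σ fun a => (μ a : ℝ) := by
    refine ⟨hUfin, hσ, isIrreducible_cyclic _ v hv0 hσ fun P hP => hline _ fun t => ?_,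
      μ, fun _ => rfl, (isWeight_iff σ μ).mpr ⟨w, hw0, hw⟩, fun ν hν => ?_⟩
    · rw [← hP]
      change P (σ _ w) = _
      rw [hw, map_smul]
    · obtain ⟨x, hx0, hx⟩ := (isWeight_iff σ ν).mp hν
      exact hweight ν x hx0 hx
  let τ : Representation ℂ (KGroup m q) U.toSubmodule := σ.comp (inclK m q)
  have hτ : CoeffContinuous τ := fun x φ => (hσ x φ).comp (continuous_inclK m q)
  -- The constituent for `K'` is generated by the same highest weight vector.
  let U' := cyclic τ w
  let σ' : Representation ℂ (KGroup m q) U'.toSubmodule := U'.toRepresentation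
  have hσ' : CoeffContinuous (V := U'.toSubmodule) U'.toRepresentation :=
    hτ.subrepresentation U'
  have hlast : ∀ z, ∀ x ∈ U'.toSubmodule,
      σ (lastCircle m q z) x = (z : ℂ) ^ μ (.inl (Fin.last m)) • x := by
    intro z x hx
    rw [← Module.End.mem_eigenspace_iff]
    refine cyclic_le (fun g x hx => ?_) ?_ hx
    · rw [Module.End.mem_eigenspace_iff] at hx ⊢
      change σ _ (σ (inclK m q g) x) = _ • σ (inclK m q g) x
      rw [← Module.End.mul_apply, ← map_mul, lastCircle_mul_inclK, map_mul, Module.End.mul_apply,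
        hx, map_smul]
    · rw [Module.End.mem_eigenspace_iff, lastCircle, hw, torusChar,
        Finset.prod_eq_single (.inl (Fin.last m))]
      · rw [Pi.mulSingle_eq_same]
      · intro b _ hb
        rw [Pi.mulSingle_eq_of_ne hb, Circle.coe_one, one_zpow]
      · simp
  -- On `U'` the last circle acts through the last coordinate of `μ`, so a weight vector for the
  -- smaller torus is one for the full torus. Dominance and the one-dimensional top weight space are
  -- thereby inherited from `U`.
  have hext : ∀ ν' (x : U'.toSubmodule), IsWeightVector σ' ν' x → ∃ ν : Idx (m + 1) q → ℤ,
      (∀ a, ν (idxEmb m q a) = ν' a) ∧ ν (.inl (Fin.last m)) = μ (.inl (Fin.last m)) ∧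
      IsWeightVector σ ν (x : U.toSubmodule) := by
    intro ν' x hx
    let ν : Idx (m + 1) q → ℤ := Sum.elim
      (Fin.snoc (α := fun _ => ℤ) (fun i => ν' (.inl i)) (μ (.inl (Fin.last m))))
      fun j => ν' (.inr j)
    have h1 : ∀ a, ν (idxEmb m q a) = ν' a := by
      rintro (a | a)
      · simp [ν, idxEmb]
      · rfl
    have h2 : ν (.inl (Fin.last m)) = μ (.inl (Fin.last m)) := by simp [ν]
    refine ⟨ν, h1, h2, fun t => ?_⟩
    rw [torus_succ, map_mul, Module.End.mul_apply, hlast _ x x.2, map_smul]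
    have h3 : σ (inclK m q (torus m q fun a => t (idxEmb m q a))) (x : U.toSubmodule) =
        torusChar ν' (fun a => t (idxEmb m q a)) • (x : U.toSubmodule) :=
      congrArg Subtype.val (hx fun a => t (idxEmb m q a))
    rw [h3, smul_smul]
    congr 1
    rw [torusChar, torusChar, prod_idx_succ, h2, mul_comm]
    simp only [h1]
  let w' : U'.toSubmodule := ⟨w, mem_cyclic τ w⟩
  have hw0' : w' ≠ 0 := fun h => hw0 (congrArg Subtype.val h)
  have hw' : IsWeightVector σ' (fun a => μ (idxEmb m q a)) w' := by
    intro t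
    refine Subtype.ext ?_
    change σ (inclK m q (torus m q t)) w = _ • w
    let s : Idx (m + 1) q → Circle := Sum.elim
      (Fin.snoc (α := fun _ => Circle) (fun i => t (.inl i)) 1) fun j => t (.inr j)
    have h1 : ∀ a, s (idxEmb m q a) = t a := by
      rintro (a | a)
      · simp [s, idxEmb]
      · rfl
    have h2 : s (.inl (Fin.last m)) = 1 := by simp [s]
    have h3 := hw s
    rw [torus_succ, h2, lastCircle, Pi.mulSingle_one, map_one, mul_one] at h3
    simp only [h1] at h3
    rw [h3, torusChar, prod_idx_succ, h2]
    simp [h1, torusChar]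
  have hirr' : IsIrrepWithHighestWeight (V := U'.toSubmodule) σ' fun a => (μ (idxEmb m q a) : ℝ) := by
    refine ⟨inferInstance, hσ', isIrreducible_cyclic _ w hw0 hσ' fun P hP => ?_,
      fun a => μ (idxEmb m q a), fun _ => rfl, (isWeight_iff (V := U'.toSubmodule) σ' _).mpr ⟨w', hw0', hw'⟩,
      fun ν' hν' => ?_⟩
    · obtain ⟨ν, h1, h2, h3⟩ := hext (fun a => μ (idxEmb m q a)) (P w') fun t => by
        rw [← hP]
        change P (σ' _ w') = _
        rw [hw', map_smul]
      have hνμ : ν = μ := by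
        funext a
        rcases a with a | a
        · refine Fin.lastCases h2 (fun i => h1 (.inl i)) a
        · exact h1 (.inr a)
      rw [hνμ] at h3
      obtain ⟨c, hc⟩ := Submodule.mem_span_singleton.mp (hline _ h3)
      exact Submodule.mem_span_singleton.mpr ⟨c, Subtype.ext hc⟩
    · obtain ⟨x, hx0, hx⟩ := (isWeight_iff (V := U'.toSubmodule) σ' ν').mp hν'
      obtain ⟨ν, h1, h2, h3⟩ := hext ν' x hx
      have h4 := (hweight ν x (fun h => hx0 (Subtype.ext h)) h3).comp_idxEmb
        (by rw [Pi.sub_apply, h2, sub_self])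
      have h5 : (fun a => (μ - ν) (idxEmb m q a)) = (fun a => μ (idxEmb m q a)) - ν' := by
        funext a
        simp [h1]
      rw [h5] at h4
      exact h4
  -- An equivariant projection onto `U'` is the intertwining map; it is nonzero because it fixes
  -- `w`.
  obtain ⟨P, hP1, hP2, hP3⟩ := exists_equivariant_projection τ hτ U'.toSubmodule
    fun g x hx => U'.apply_mem_toSubmodule g hx
  refine ⟨U.toSubmodule, U'.toSubmodule, inferInstance, inferInstance, inferInstance,
    inferInstance, σ, σ', hirr, hirr',
    LinearMap.intertwiningMap_of_isIntertwiningMap _ _ (P.codRestrict _ hP1)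
      fun g x => Subtype.ext (hP3 g x), fun h0 => hw0 ?_⟩
  have h1 : P.codRestrict _ hP1 w = 0 := congrArg (fun f => f w) h0
  rw [← hP2 w (mem_cyclic τ w)]
  exact congrArg Subtype.val h1

theorem occursInRestriction_of_dominant {m q : ℕ} {μ : Idx (m + 1) q → ℝ} {μ' : Idx m q → ℝ}
    (hint : ∀ a, ∃ k : ℤ, μ a = k) (h1 : Antitone fun i => μ (.inl i))
    (h2 : Antitone fun j => μ (.inr j)) (h : ∀ a, μ' a = μ (idxEmb m q a)) :
    OccursInRestriction μ μ' := by
  choose ω hω using hint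
  obtain rfl : μ = fun a => (ω a : ℝ) := funext hω
  obtain rfl : μ' = fun a => (ω (idxEmb m q a) : ℝ) := funext h
  exact (hasFunctionModel_of_dominant ω (fun i j hij => Int.cast_le.mp (h1 hij))
    (fun i j hij => Int.cast_le.mp (h2 hij))).occursInRestriction

/-! ### Words -/

theorem exists_occurrence_iff {α : Type} [DecidableEq α] (t : List α) (y : α) (j : ℕ) :
    (∃ l, t[l]? = some y ∧ (t.take l).count y = j) ↔ j < t.count y := by
  induction t generalizing j with
  | nil => simp
  | cons a t ih =>
    constructor
    · rintro ⟨_ | l, h1, h2⟩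
      · obtain rfl : a = y := by simpa using h1
        have : j = 0 := by simpa using h2.symm
        simp [this]
      · have h3 := (ih (j := (t.take l).count y)).mp ⟨l, by simpa using h1, rfl⟩
        rw [← h2, List.take_succ_cons, List.count_cons, List.count_cons]
        omega
    · intro h
      by_cases hay : a = y
      · subst hay
        cases j with
        | zero => exact ⟨0, by simp⟩
        | succ j =>
          obtain ⟨l, h1, h2⟩ := (ih j).mpr (by simpa using h)
          exact ⟨l + 1, by simpa using h1, by simp [h2]⟩
      · obtain ⟨l, h1, h2⟩ := (ih j).mpr (by simpa [hay] using h)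
        exact ⟨l + 1, by simpa using h1, by simp [h2, hay]⟩

section Precedes

variable {α : Type} [DecidableEq α] {t : List α} {a x y : α} {i j : ℕ}

theorem not_precedes_nil : ¬ Precedes ([] : List α) x i y j := by
  rintro ⟨k, l, -, ⟨h, -⟩, -⟩
  simp at h

theorem precedes_cons_self_zero (h : x ≠ y) : Precedes (x :: t) x 0 y j ↔ j < t.count y := by
  rw [← exists_occurrence_iff]
  constructor
  · rintro ⟨k, _ | l, hkl, -, h1, h2⟩
    · omega
    · exact ⟨l, by simpa using h1, by simpa [h] using h2⟩
  · rintro ⟨l, h1, h2⟩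
    exact ⟨0, l + 1, by omega, by simp, by simpa using h1, by simpa [h] using h2⟩

/-- A letter put in front raises its own occurrence numbers by one. The excluded case is the one in
which that letter is itself the occurrence of `x` in question. -/
theorem precedes_cons_iff (h : ¬ (a = x ∧ i = 0)) : Precedes (a :: t) x i y j ↔
    ∃ i' j', Precedes t x i' y j' ∧ i' + (if a = x then 1 else 0) = i ∧
      j' + (if a = y then 1 else 0) = j := by
  constructor
  · rintro ⟨_ | k, _ | l, hkl, ⟨h1, h2⟩, h3, h4⟩
    · omega
    · exact absurd ⟨by simpa using h1, by simpa using h2.symm⟩ h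
    · omega
    · refine ⟨_, _, ⟨k, l, by omega, ⟨by simpa using h1, rfl⟩, by simpa using h3, rfl⟩, ?_, ?_⟩
      · rw [← h2, List.take_succ_cons, List.count_cons]; simp
      · rw [← h4, List.take_succ_cons, List.count_cons]; simp
  · rintro ⟨_, _, ⟨k, l, hkl, ⟨h1, rfl⟩, h3, rfl⟩, rfl, rfl⟩
    refine ⟨k + 1, l + 1, by omega, ⟨by simpa using h1, ?_⟩, by simpa using h3, ?_⟩
    · rw [List.take_succ_cons, List.count_cons]; simp
    · rw [List.take_succ_cons, List.count_cons]; simp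

theorem precedes_cons_self_succ (h : x ≠ y) :
    Precedes (x :: t) x (i + 1) y j ↔ Precedes t x i y j := by
  rw [precedes_cons_iff (by simp)]
  simp [h]

theorem precedes_cons_right_succ (h : x ≠ y) :
    Precedes (y :: t) x i y (j + 1) ↔ Precedes t x i y j := by
  rw [precedes_cons_iff (by simp [h.symm])]
  simp [h.symm]

theorem not_precedes_cons_right_zero (h : x ≠ y) : ¬ Precedes (y :: t) x i y 0 := by
  rw [precedes_cons_iff (by simp [h.symm])]
  simp

theorem precedes_cons_of_ne (hx : a ≠ x) (hy : a ≠ y) :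
    Precedes (a :: t) x i y j ↔ Precedes t x i y j := by
  rw [precedes_cons_iff (by simp [hx])]
  simp [hx, hy]

end Precedes

theorem deco_cons (a : Symbol) (s : List Symbol) :
    deco (a :: s) = (Symbol.uncircled a).toList ++ deco s := by
  cases a <;> rfl

theorem deco'_cons (a : Symbol) (s : List Symbol) :
    deco' (a :: s) = (Symbol.circled a).toList ++ deco' s := by
  cases a <;> rfl

theorem count_deco_plus (s : List Symbol) : (deco s).count .plus = s.count .plus := by
  induction s with
  | nil => rfl
  | cons a s ih => rw [deco_cons, List.count_append, ih]; cases a <;> simp [Symbol.uncircled, add_comm]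

theorem count_deco_minus (s : List Symbol) : (deco s).count .minus = s.count .minus := by
  induction s with
  | nil => rfl
  | cons a s ih => rw [deco_cons, List.count_append, ih]; cases a <;> simp [Symbol.uncircled, add_comm]

theorem count_deco'_plus (s : List Symbol) : (deco' s).count .plus = s.count .oplus := by
  induction s with
  | nil => rfl
  | cons a s ih => rw [deco'_cons, List.count_append, ih]; cases a <;> simp [Symbol.circled, add_comm]

theorem count_deco'_minus (s : List Symbol) : (deco' s).count .minus = s.count .ominus := by
  induction s with
  | nil => rfl
  | cons a s ih => rw [deco'_cons, List.count_append, ih]; cases a <;> simp [Symbol.circled, add_comm]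

theorem isSignature_iff (m q : ℕ) (s : List Symbol) : IsSignature m q s ↔
    (s.count .plus = m + 1 ∧ s.count .minus = q) ∧ s.count .oplus = m ∧ s.count .ominus = q := by
  rw [IsSignature, IsDecoration, IsDecoration, count_deco_plus, count_deco_minus,
    count_deco'_plus, count_deco'_minus]

/-! ### Reductions -/

theorem reflTransGen_weakStep_of_step {s : List Symbol}
    (h : Relation.ReflTransGen Step s [.plus]) : Relation.ReflTransGen WeakStep s [.plus] := by
  induction h using Relation.ReflTransGen.head_induction_on with
  | refl => exact .refl
  | head hst _ ih =>
    cases hst with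
    | plus_oplus => exact .head (.plus_oplus _) ih
    | ominus_minus => exact .head (.ominus_minus _) ih
    | oplus_plus =>
      -- A deletion on the right is postponed: the shorter word is reduced to `+` with the suffix
      -- `⊕+` carried along, and `+⊕+` loses its left pair.
      refine .tail (b := [.plus] ++ [.oplus, .plus]) ?_ (.plus_oplus _)
      exact Relation.ReflTransGen.lift (r := WeakStep) (p := WeakStep)
        (fun l : List Symbol => l ++ [.oplus, .plus]) (fun a b hab => by
          cases hab
          · exact .plus_oplus _
          · exact .ominus_minus _) _ _ ih

theorem reflTransGen_step_of_weakStep {s : List Symbol}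
    (h : Relation.ReflTransGen WeakStep s [.plus]) : Relation.ReflTransGen Step s [.plus] :=
  Relation.ReflTransGen.mono (fun _ _ hab => by
    cases hab
    · exact .plus_oplus _
    · exact .ominus_minus _) _ _ h

theorem getLast?_of_reduces {s : List Symbol} (h : Relation.ReflTransGen WeakStep s [.plus]) :
    s.getLast? = some .plus := by
  induction h using Relation.ReflTransGen.head_induction_on with
  | refl => rfl
  | head hst _ ih => cases hst <;> simp [List.getLast?_cons, ih]

/-- Both symbols of a deleted pair carry the same sign, one for `δ` and one for `δ'`; the final `+`
belongs to `δ` alone. -/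
theorem condDeltaPlus_of_reduces {s : List Symbol}
    (h : Relation.ReflTransGen WeakStep s [.plus]) : CondDeltaPlus s := by
  induction h using Relation.ReflTransGen.head_induction_on with
  | refl => rfl
  | head hst _ ih =>
    unfold CondDeltaPlus at ih ⊢
    cases hst <;> simp [deco_cons, deco'_cons, Symbol.uncircled, Symbol.circled, ih]

theorem degree_append_plus (δ : List Sign) : degree (δ ++ [.plus]) = degree δ := by
  unfold degree
  congr 1
  ext ⟨k, l⟩
  simp only [Finset.mem_filter, Finset.mem_product, Finset.mem_range, List.length_append,
    List.length_singleton]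
  constructor
  · rintro ⟨⟨_, hl⟩, hkl, h1, h2⟩
    have hl' : l < δ.length := by
      by_contra h
      obtain rfl : l = δ.length := by omega
      simp at h2
    rw [List.getElem?_append_left (by omega)] at h1 h2
    exact ⟨⟨by omega, hl'⟩, hkl, h1, h2⟩
  · rintro ⟨⟨hk, hl⟩, hkl, h1, h2⟩
    rw [List.getElem?_append_left (by omega), List.getElem?_append_left (by omega)]
    exact ⟨⟨by omega, by omega⟩, hkl, h1, h2⟩

theorem precedes_append_plus (δ : List Sign) (i j : ℕ) :
    Precedes (δ ++ [.plus]) .plus i .minus j ↔ Precedes δ .plus i .minus j := by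
  induction δ generalizing i j with
  | nil =>
    rw [List.nil_append]
    refine iff_of_false ?_ not_precedes_nil
    cases i with
    | zero => rw [precedes_cons_self_zero (by simp)]; simp
    | succ i => rw [precedes_cons_self_succ (by simp)]; exact not_precedes_nil
  | cons a δ ih =>
    rw [List.cons_append]
    cases a with
    | plus =>
      cases i with
      | zero => simp [precedes_cons_self_zero]
      | succ i => rw [precedes_cons_self_succ (by simp), precedes_cons_self_succ (by simp), ih]
    | minus =>
      cases j with
      | zero => simp [not_precedes_cons_right_zero]
      | succ j => rw [precedes_cons_right_succ (by simp), precedes_cons_right_succ (by simp), ih]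

theorem CondDeltaPlus.condQ {s : List Symbol} (h : CondDeltaPlus s) : CondQ s := by
  rw [CondQ, h, degree_append_plus]

theorem CondDeltaPlus.condNC {s : List Symbol} (h : CondDeltaPlus s) : CondNC s := by
  rw [CondNC, h]
  ext x
  exact precedes_append_plus _ _ _

/-- Restoring a deleted pair shifts the occurrence numbers of its two symbols by one. The only new
inequalities concern first occurrences and hold because the pair stands in front. -/
theorem condMinusOminusMinus_of_reduces {s : List Symbol}
    (h : Relation.ReflTransGen WeakStep s [.plus]) :
    ∀ m q, IsSignature m q s → CondMinusOminusMinus m q s := by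
  induction h using Relation.ReflTransGen.head_induction_on with
  | refl =>
    intro m q hs
    simp only [isSignature_iff] at hs
    obtain ⟨⟨h1, h2⟩, h3, h4⟩ := hs
    obtain rfl : m = 0 := by simpa using h3.symm
    obtain rfl : q = 0 := by simpa using h4.symm
    exact ⟨by simp, by simp, by simp⟩
  | head hst _ ih =>
    intro m q hs
    simp only [isSignature_iff] at hs ih
    cases hst with
    | plus_oplus =>
      obtain ⟨⟨h1, h2⟩, h3, h4⟩ := hs
      simp at h1 h2 h3 h4
      obtain ⟨m, rfl⟩ : ∃ n, m = n + 1 := ⟨m - 1, by omega⟩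
      obtain ⟨c1, c2, c3⟩ := ih m q ⟨⟨by omega, h2⟩, by omega, h4⟩
      refine ⟨?_, ?_, ?_⟩
      · rintro (_ | i) hi
        · rw [precedes_cons_self_zero (by simp), zero_add, precedes_cons_right_succ (by simp),
            precedes_cons_self_zero (by simp)]
          exact ⟨by simp, by omega⟩
        · simpa [precedes_cons_self_succ, precedes_cons_right_succ] using c1 i (by omega)
      · intro j hj
        simpa [precedes_cons_of_ne] using c2 j hj
      · intro j hj
        simpa [precedes_cons_of_ne] using c3 j hj
    | ominus_minus =>
      obtain ⟨⟨h1, h2⟩, h3, h4⟩ := hs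
      simp at h1 h2 h3 h4
      obtain ⟨q, rfl⟩ : ∃ n, q = n + 1 := ⟨q - 1, by omega⟩
      obtain ⟨c1, c2, c3⟩ := ih m q ⟨⟨h1, by omega⟩, h3, by omega⟩
      refine ⟨?_, ?_, ?_⟩
      · intro i hi
        simpa [precedes_cons_of_ne] using c1 i hi
      · rintro (_ | j) hj
        · simp [precedes_cons_self_zero]
        · simpa [precedes_cons_self_succ, precedes_cons_right_succ] using c2 j (by omega)
      · rintro (_ | j) hj
        · rw [zero_add, precedes_cons_right_succ (by simp), precedes_cons_self_zero (by simp)]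
          omega
        · simpa [precedes_cons_self_succ, precedes_cons_right_succ] using c3 j (by omega)

/-- A first `⊕` needs a `+` before it and a first `-` needs a `⊖`. With the adjacency rules the word
is `+` or begins with `+⊕` or `⊖-`, and the condition survives the deletion. -/
theorem reduces_of_condMinusOminusMinus (s : List Symbol) :
    ∀ m q, IsSignature m q s → IsGGPPattern s → CondMinusOminusMinus m q s →
      Relation.ReflTransGen WeakStep s [.plus] := by
  induction h : s.length using Nat.strong_induction_on generalizing s with
  | _ n ih =>
  intro m q hs hG hc
  simp only [isSignature_iff] at hs ih
  obtain ⟨⟨h1, h2⟩, h3, h4⟩ := hs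
  obtain ⟨c1, c2, c3⟩ := hc
  have first1 : ∀ t, s = .oplus :: t → False := by
    rintro t rfl
    simp at h3
    exact not_precedes_cons_right_zero (by simp) (c1 0 (by omega)).1
  have first2 : ∀ t, s = .minus :: t → False := by
    rintro t rfl
    simp at h2
    exact not_precedes_cons_right_zero (by simp) (c2 0 (by omega))
  match s, hG with
  | [], _ => simp at h1
  | [.plus], _ => exact .refl
  | .plus :: .oplus :: t, hG =>
    simp at h1 h2 h3 h4 h
    obtain ⟨m, rfl⟩ : ∃ n, m = n + 1 := ⟨m - 1, by omega⟩
    refine .head (.plus_oplus t) (ih _ (by omega) t rfl m q ⟨⟨by omega, h2⟩, by omega, h4⟩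
      hG.tail.tail ⟨?_, ?_, ?_⟩)
    · intro i hi
      simpa [precedes_cons_self_succ, precedes_cons_right_succ] using c1 (i + 1) (by omega)
    · intro j hj
      simpa [precedes_cons_of_ne] using c2 j hj
    · intro j hj
      simpa [precedes_cons_of_ne] using c3 j hj
  | .plus :: .minus :: t, _ =>
    exfalso
    simp at h2
    have := c2 0 (by omega)
    rw [precedes_cons_of_ne (by simp) (by simp)] at this
    exact not_precedes_cons_right_zero (by simp) this
  | .plus :: .plus :: t, hG => cases (List.isChain_cons_cons.mp hG).1
  | .plus :: .ominus :: t, hG => cases (List.isChain_cons_cons.mp hG).1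
  | .oplus :: t, _ => exact (first1 t rfl).elim
  | .minus :: t, _ => exact (first2 t rfl).elim
  | .ominus :: .minus :: t, hG =>
    simp at h1 h2 h3 h4 h
    obtain ⟨q, rfl⟩ : ∃ n, q = n + 1 := ⟨q - 1, by omega⟩
    refine .head (.ominus_minus t) (ih _ (by omega) t rfl m q ⟨⟨h1, by omega⟩, h3, by omega⟩
      hG.tail.tail ⟨?_, ?_, ?_⟩)
    · intro i hi
      simpa [precedes_cons_of_ne] using c1 i hi
    · intro j hj
      simpa [precedes_cons_self_succ, precedes_cons_right_succ] using c2 (j + 1) (by omega)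
    · intro j hj
      simpa [precedes_cons_self_succ, precedes_cons_right_succ] using c3 (j + 1) (by omega)
  | .ominus :: .oplus :: t, _ =>
    exfalso
    simp at h3
    have := (c1 0 (by omega)).1
    rw [precedes_cons_of_ne (by simp) (by simp)] at this
    exact not_precedes_cons_right_zero (by simp) this
  | [.ominus], _ => simp at h1
  | .ominus :: .plus :: t, hG => cases (List.isChain_cons_cons.mp hG).1
  | .ominus :: .ominus :: t, hG => cases (List.isChain_cons_cons.mp hG).1

/-! ### Words in which minus signs come in pairs -/

/-- The allowed adjacent pairs in a pattern in which `⊖` and `-` occur only in substrings `⊖-`. -/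
def PairedAdjacent (a b : Symbol) : Prop := GGPAdjacent a b ∧ (a = .ominus ↔ b = .minus)

/-- Once the pairs `⊖-` are removed, `⊕` and `+` alternate starting with `⊕`, so `+` is never in the
majority. The leading `⊕` accounts for the 1. -/
theorem count_plus_le_of_isChain_oplus_cons (t : List Symbol)
    (h : (Symbol.oplus :: t).IsChain PairedAdjacent)
    (hlast : (Symbol.oplus :: t).getLast? ≠ some .ominus) :
    t.count .plus ≤ t.count .oplus + 1 := by
  induction hn : t.length using Nat.strong_induction_on generalizing t with
  | _ n ih =>
  match t, h with
  | [], _ => simp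
  | [.plus], _ => simp
  | .plus :: .oplus :: t, h =>
    have h1 := ih t.length (by simp at hn; omega) t h.tail.tail
      (by simpa [List.getLast?_cons] using hlast) rfl
    simp
    omega
  | .plus :: .plus :: t, h => cases (List.isChain_cons_cons.mp h.tail).1.1
  | .plus :: .minus :: t, h =>
    have := (List.isChain_cons_cons.mp h.tail).1.2
    simp at this
  | .plus :: .ominus :: t, h => cases (List.isChain_cons_cons.mp h.tail).1.1
  | .oplus :: t, h => cases (List.isChain_cons_cons.mp h).1.1
  | .minus :: t, h => cases (List.isChain_cons_cons.mp h).1.1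
  | [.ominus], _ => simp at hlast
  | .ominus :: .minus :: t, h =>
    -- Only `+` or `⊖` may follow `-`, and both may follow `⊕`.
    have h0 : (Symbol.oplus :: t).IsChain PairedAdjacent := by
      match t, h with
      | [], _ => exact .singleton _
      | .plus :: t, h => exact h.tail.tail.tail.cons_cons ⟨.oplus_plus, by simp⟩
      | .minus :: t, h => cases (List.isChain_cons_cons.mp h.tail.tail).1.1
      | .oplus :: t, h => cases (List.isChain_cons_cons.mp h.tail.tail).1.1
      | .ominus :: t, h => exact h.tail.tail.tail.cons_cons ⟨.oplus_ominus, by simp⟩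
    have h1 := ih t.length (by simp at hn; omega) t h0 (by
      rcases List.eq_nil_or_concat t with rfl | ⟨t', a, rfl⟩
      · simp
      · simpa [List.getLast?_cons] using hlast) rfl
    simpa using h1
  | .ominus :: .plus :: t, h => cases (List.isChain_cons_cons.mp h.tail).1.1
  | .ominus :: .oplus :: t, h =>
    have := (List.isChain_cons_cons.mp h.tail).1.2
    simp at this
  | .ominus :: .ominus :: t, h => cases (List.isChain_cons_cons.mp h.tail).1.1

/-- The surplus of one `+` excludes a leading `⊕`. The conditions at the two ends exclude an
unpaired `-` or `⊖`, which the adjacency condition alone cannot see. -/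
theorem reduces_of_isChain (s : List Symbol) (h : s.IsChain PairedAdjacent)
    (hhead : s.head? ≠ some .minus) (hlast : s.getLast? ≠ some .ominus)
    (hcount : s.count .plus = s.count .oplus + 1) :
    Relation.ReflTransGen WeakStep s [.plus] := by
  induction hn : s.length using Nat.strong_induction_on generalizing s with
  | _ n ih =>
  match s, h with
  | [], _ => simp at hcount
  | .minus :: t, _ => simp at hhead
  | .oplus :: t, h =>
    have := count_plus_le_of_isChain_oplus_cons t h hlast
    simp at hcount
    omega
  | [.plus], _ => exact .refl
  | .plus :: .oplus :: t, h =>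
    refine .head (.plus_oplus t) (ih _ (by simp at hn; omega) t h.tail.tail ?_ ?_
      (by simp at hcount; omega) rfl)
    · match t, h with
      | [], _ => simp
      | .minus :: t, h => cases (List.isChain_cons_cons.mp h.tail).1.1
      | .plus :: t, _ => simp
      | .oplus :: t, _ => simp
      | .ominus :: t, _ => simp
    · rcases List.eq_nil_or_concat t with rfl | ⟨t', a, rfl⟩
      · simp
      · simpa [List.getLast?_cons] using hlast
  | .plus :: .plus :: t, h => cases (List.isChain_cons_cons.mp h).1.1
  | .plus :: .minus :: t, h =>
    have := (List.isChain_cons_cons.mp h).1.2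
    simp at this
  | .plus :: .ominus :: t, h => cases (List.isChain_cons_cons.mp h).1.1
  | [.ominus], _ => simp at hlast
  | .ominus :: .minus :: t, h =>
    refine .head (.ominus_minus t) (ih _ (by simp at hn; omega) t h.tail.tail ?_ ?_
      (by simpa using hcount) rfl)
    · match t, h with
      | [], _ => simp
      | .minus :: t, h => cases (List.isChain_cons_cons.mp h.tail).1.1
      | .plus :: t, _ => simp
      | .oplus :: t, _ => simp
      | .ominus :: t, _ => simp
    · rcases List.eq_nil_or_concat t with rfl | ⟨t', a, rfl⟩
      · simp
      · simpa [List.getLast?_cons] using hlast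
  | .ominus :: .plus :: t, h => cases (List.isChain_cons_cons.mp h).1.1
  | .ominus :: .oplus :: t, h =>
    have := (List.isChain_cons_cons.mp h).1.2
    simp at this
  | .ominus :: .ominus :: t, h => cases (List.isChain_cons_cons.mp h).1.1

/-- A reducible pattern is a sequence of blocks `+⊕`, `⊖-` followed by `+`. -/
theorem exists_blocks_of_reduces {s : List Symbol}
    (h : Relation.ReflTransGen WeakStep s [.plus]) : ∀ m q, IsSignature m q s →
    ∃ L : List (Fin m ⊕ Fin q),
      s = L.flatMap (Sum.elim (fun _ => [.plus, .oplus]) fun _ => [.ominus, .minus]) ++ [.plus] ∧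
      (∀ a, a ∈ L) ∧
      L.Pairwise fun a b => (∀ i j, a = .inl i → b = .inl j → i < j) ∧
        ∀ i j, a = .inr i → b = .inr j → i < j := by
  induction h using Relation.ReflTransGen.head_induction_on with
  | refl =>
    intro m q hs
    simp only [isSignature_iff] at hs
    obtain ⟨⟨h1, h2⟩, h3, h4⟩ := hs
    obtain rfl : m = 0 := by simpa using h3.symm
    obtain rfl : q = 0 := by simpa using h4.symm
    exact ⟨[], rfl, fun a => isEmptyElim a, .nil⟩
  | head hst _ ih =>
    intro m q hs
    simp only [isSignature_iff] at hs ih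
    cases hst with
    | plus_oplus =>
      obtain ⟨⟨h1, h2⟩, h3, h4⟩ := hs
      simp at h1 h2 h3 h4
      obtain ⟨m, rfl⟩ : ∃ n, m = n + 1 := ⟨m - 1, by omega⟩
      obtain ⟨L, hL, hmem, hp⟩ := ih m q ⟨⟨by omega, h2⟩, by omega, h4⟩
      refine ⟨.inl 0 :: L.map (Sum.map Fin.succ id), ?_, ?_, ?_⟩
      · rw [hL, List.flatMap_cons, List.flatMap_map]
        simp only [Sum.elim_inl, List.cons_append, List.nil_append]
        congr 4
        funext a
        cases a <;> rfl
      · rintro (i | j)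
        · refine Fin.cases (by simp) (fun i => ?_) i
          exact List.mem_cons_of_mem _ (List.mem_map.mpr ⟨.inl i, hmem _, rfl⟩)
        · exact List.mem_cons_of_mem _ (List.mem_map.mpr ⟨.inr j, hmem _, rfl⟩)
      · refine List.pairwise_cons.mpr ⟨?_, List.pairwise_map.mpr (hp.imp ?_)⟩
        · rintro b hb
          obtain ⟨b, -, rfl⟩ := List.mem_map.mp hb
          rcases b with b | b <;> simp
        · rintro (a | a) (b | b) hab <;> simp at hab ⊢ <;> exact hab
    | ominus_minus =>
      obtain ⟨⟨h1, h2⟩, h3, h4⟩ := hs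
      simp at h1 h2 h3 h4
      obtain ⟨q, rfl⟩ : ∃ n, q = n + 1 := ⟨q - 1, by omega⟩
      obtain ⟨L, hL, hmem, hp⟩ := ih m q ⟨⟨h1, by omega⟩, h3, by omega⟩
      refine ⟨.inr 0 :: L.map (Sum.map id Fin.succ), ?_, ?_, ?_⟩
      · rw [hL, List.flatMap_cons, List.flatMap_map]
        simp only [Sum.elim_inr, List.cons_append, List.nil_append]
        congr 4
        funext a
        cases a <;> rfl
      · rintro (i | j)
        · exact List.mem_cons_of_mem _ (List.mem_map.mpr ⟨.inl i, hmem _, rfl⟩)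
        · refine Fin.cases (by simp) (fun i => ?_) j
          exact List.mem_cons_of_mem _ (List.mem_map.mpr ⟨.inr i, hmem _, rfl⟩)
      · refine List.pairwise_cons.mpr ⟨?_, List.pairwise_map.mpr (hp.imp ?_)⟩
        · rintro b hb
          obtain ⟨b, -, rfl⟩ := List.mem_map.mp hb
          rcases b with b | b <;> simp
        · rintro (a | a) (b | b) hab <;> simp at hab ⊢ <;> exact hab

/-! ### The vectors `ρ` and the parameters in coordinates -/

/-- A coordinate of the half sum is half the number of roots leaving `d` minus those entering it.
`F` and `G` are the two indicator functions, left free so that they can be given blockwise. -/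
theorem halfSum_eq {p q : ℕ} {R : Idx p q → Idx p q → Prop} {d : Idx p q} (F G : Idx p q → ℝ)
    (hF : ∀ b, (R d b ∧ F b = 1) ∨ (¬ R d b ∧ F b = 0))
    (hG : ∀ a, (R a d ∧ G a = 1) ∨ (¬ R a d ∧ G a = 0)) :
    halfSum R d = (∑ b, F b - ∑ a, G a) / 2 := by
  classical
  have h : ∀ a b, (if R a b then (Pi.single a 1 - Pi.single b 1 : Idx p q → ℝ) else 0) d =
      (if d = a then F b else 0) - if d = b then G a else 0 := by
    intro a b
    by_cases hR : R a b
    · have h1 : d = a → F b = 1 := fun h => by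
        subst h; exact ((hF b).resolve_right fun h => h.1 hR).2
      have h2 : d = b → G a = 1 := fun h => by
        subst h; exact ((hG a).resolve_right fun h => h.1 hR).2
      rw [if_pos hR, Pi.sub_apply, Pi.single_apply, Pi.single_apply]
      congr 1 <;> split_ifs with hd
      · exact (h1 hd).symm
      · rfl
      · exact (h2 hd).symm
      · rfl
    · have h1 : d = a → F b = 0 := fun h => by
        subst h; exact ((hF b).resolve_left fun h => hR h.1).2
      have h2 : d = b → G a = 0 := fun h => by
        subst h; exact ((hG a).resolve_left fun h => hR h.1).2
      rw [if_neg hR, Pi.zero_apply, ite_eq_right_iff.mpr h1, ite_eq_right_iff.mpr h2, sub_zero]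
  rw [halfSum, Pi.smul_apply, Finset.sum_apply]
  simp only [Finset.sum_apply, h, Finset.sum_sub_distrib, Finset.sum_ite_eq, Finset.mem_univ,
    if_true]
  rw [Finset.sum_comm]
  simp only [Finset.sum_ite_eq, Finset.mem_univ, if_true, smul_eq_mul]
  ring

theorem sum_ite_gt {n : ℕ} (i : Fin n) :
    ∑ j : Fin n, (if i < j then (1 : ℝ) else 0) = n - 1 - i := by
  rw [Finset.sum_boole]
  have : (Finset.univ.filter fun j => i < j) = Finset.Ioi i := by ext; simp
  rw [this, Fin.card_Ioi]
  have := i.2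
  rw [Nat.sub_sub, Nat.cast_sub (by omega)]
  push_cast
  ring

theorem sum_ite_lt {n : ℕ} (i : Fin n) :
    ∑ j : Fin n, (if j < i then (1 : ℝ) else 0) = i := by
  rw [Finset.sum_boole]
  have : (Finset.univ.filter fun j => j < i) = Finset.Iio i := by ext; simp
  rw [this, Fin.card_Iio]

theorem rhoG_inl {p q : ℕ} (i : Fin p) : rhoG p q (.inl i) = ((p : ℝ) + q - 1 - 2 * i) / 2 := by
  rw [rhoG, halfSum_eq
    (Sum.elim (fun j => if i < j then 1 else 0) fun _ => 1)
    (Sum.elim (fun j => if j < i then 1 else 0) fun _ => 0)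
    (by rintro (b | b) <;> simp [PosRoot, lt_or_ge]) (by rintro (b | b) <;> simp [PosRoot, lt_or_ge])]
  simp only [Fintype.sum_sum_type, Sum.elim_inl, Sum.elim_inr, sum_ite_gt, sum_ite_lt,
    Finset.sum_const, Finset.card_univ, Fintype.card_fin, nsmul_eq_mul]
  ring

theorem rhoG_inr {p q : ℕ} (j : Fin q) : rhoG p q (.inr j) = ((q : ℝ) - 1 - 2 * j - p) / 2 := by
  rw [rhoG, halfSum_eq
    (Sum.elim (fun _ => 0) fun i => if j < i then 1 else 0)
    (Sum.elim (fun _ => 1) fun i => if i < j then 1 else 0)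
    (by rintro (b | b) <;> simp [PosRoot, lt_or_ge]) (by rintro (b | b) <;> simp [PosRoot, lt_or_ge])]
  simp only [Fintype.sum_sum_type, Sum.elim_inl, Sum.elim_inr, sum_ite_gt, sum_ite_lt,
    Finset.sum_const, Finset.card_univ, Fintype.card_fin, nsmul_eq_mul]
  ring

theorem rhoC_inl {p q : ℕ} (i : Fin p) : rhoC p q (.inl i) = ((p : ℝ) - 1 - 2 * i) / 2 := by
  rw [rhoC, halfSum_eq
    (Sum.elim (fun j => if i < j then 1 else 0) fun _ => 0)
    (Sum.elim (fun j => if j < i then 1 else 0) fun _ => 0)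
    (by rintro (b | b) <;> simp [CompactPosRoot, lt_or_ge]) (by rintro (b | b) <;> simp [CompactPosRoot, lt_or_ge])]
  simp only [Fintype.sum_sum_type, Sum.elim_inl, Sum.elim_inr, sum_ite_gt, sum_ite_lt,
    Finset.sum_const, Finset.card_univ, Fintype.card_fin, nsmul_eq_mul]
  ring

theorem rhoC_inr {p q : ℕ} (j : Fin q) : rhoC p q (.inr j) = ((q : ℝ) - 1 - 2 * j) / 2 := by
  rw [rhoC, halfSum_eq
    (Sum.elim (fun _ => 0) fun i => if j < i then 1 else 0)
    (Sum.elim (fun _ => 0) fun i => if i < j then 1 else 0)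
    (by rintro (b | b) <;> simp [CompactPosRoot, lt_or_ge]) (by rintro (b | b) <;> simp [CompactPosRoot, lt_or_ge])]
  simp only [Fintype.sum_sum_type, Sum.elim_inl, Sum.elim_inr, sum_ite_gt, sum_ite_lt,
    Finset.sum_const, Finset.card_univ, Fintype.card_fin, nsmul_eq_mul]
  ring

/-- The number of coordinates `λ_{p+j}` below `λ_i`. -/
noncomputable def numBelow {p q : ℕ} (lam : Idx p q → ℝ) (i : Fin p) : ℕ :=
  (Finset.univ.filter fun j : Fin q => lam (.inr j) < lam (.inl i)).card

/-- The number of coordinates `λ_i` above `λ_{p+j}`. -/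
noncomputable def numAbove {p q : ℕ} (lam : Idx p q → ℝ) (j : Fin q) : ℕ :=
  (Finset.univ.filter fun i : Fin p => lam (.inr j) < lam (.inl i)).card

theorem sum_ite_add_sum_ite {n : ℕ} (P Q : Fin n → Prop) [DecidablePred P] [DecidablePred Q]
    (h : ∀ j, P j ↔ ¬ Q j) :
    ∑ j, (if P j then (1 : ℝ) else 0) = n - ∑ j, if Q j then (1 : ℝ) else 0 := by
  rw [eq_sub_iff_add_eq, ← Finset.sum_add_distrib]
  have : ∀ j, ((if P j then (1 : ℝ) else 0) + if Q j then (1 : ℝ) else 0) = 1 := by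
    intro j
    by_cases hq : Q j
    · simp [hq, (h j).not.mpr (not_not.mpr hq)]
    · simp [hq, (h j).mpr hq]
  simp [this]

theorem IsHCParam.inr_ne_inl {p q : ℕ} {lam : Idx p q → ℝ} (h : IsHCParam lam) (i : Fin p)
    (j : Fin q) : lam (.inr j) ≠ lam (.inl i) := fun he => by
  have := h.2.1 he
  simp at this

/-- Strict decrease within each factor makes the compact part of `ρ(λ)` equal to `ρ_c`; the
noncompact roots contribute `numBelow` minus `q / 2`. -/
theorem blattner_inl {p q : ℕ} {lam : Idx p q → ℝ} (h : IsHCParam lam) (i : Fin p) :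
    blattner lam (.inl i) = lam (.inl i) - ((p : ℝ) - 1 - 2 * i) / 2 + numBelow lam i - q / 2 := by
  have h1 : (∑ j : Fin q, if lam (.inl i) < lam (.inr j) then (1 : ℝ) else 0) =
      q - ∑ j : Fin q, if lam (.inr j) < lam (.inl i) then (1 : ℝ) else 0 :=
    sum_ite_add_sum_ite _ _ fun j => by
      rw [not_lt, le_iff_lt_or_eq, or_iff_left (h.inr_ne_inl i j).symm]
  rw [blattner, Pi.sub_apply, Pi.add_apply, Pi.smul_apply, rhoC_inl, rhoOf, halfSum_eq
    (Sum.elim (fun j => if i < j then 1 else 0)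
      fun j => if lam (.inr j) < lam (.inl i) then 1 else 0)
    (Sum.elim (fun j => if j < i then 1 else 0)
      fun j => if lam (.inl i) < lam (.inr j) then 1 else 0)
    (by rintro (b | b) <;> simp [h.2.2.1.lt_iff_gt, lt_or_ge])
    (by rintro (b | b) <;> simp [h.2.2.1.lt_iff_gt, lt_or_ge])]
  simp only [Fintype.sum_sum_type, Sum.elim_inl, Sum.elim_inr, sum_ite_gt, sum_ite_lt, h1,
    smul_eq_mul]
  rw [Finset.sum_boole, ← numBelow]
  ring

theorem blattner_inr {p q : ℕ} {lam : Idx p q → ℝ} (h : IsHCParam lam) (j : Fin q) :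
    blattner lam (.inr j) = lam (.inr j) - ((q : ℝ) - 1 - 2 * j) / 2 + p / 2 - numAbove lam j := by
  have h1 : (∑ i : Fin p, if lam (.inl i) < lam (.inr j) then (1 : ℝ) else 0) =
      p - ∑ i : Fin p, if lam (.inr j) < lam (.inl i) then (1 : ℝ) else 0 :=
    sum_ite_add_sum_ite _ _ fun i => by
      rw [not_lt, le_iff_lt_or_eq, or_iff_left (h.inr_ne_inl i j).symm]
  rw [blattner, Pi.sub_apply, Pi.add_apply, Pi.smul_apply, rhoC_inr, rhoOf, halfSum_eq
    (Sum.elim (fun i => if lam (.inl i) < lam (.inr j) then 1 else 0)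
      fun i => if j < i then 1 else 0)
    (Sum.elim (fun i => if lam (.inr j) < lam (.inl i) then 1 else 0)
      fun i => if i < j then 1 else 0)
    (by rintro (b | b) <;> simp [h.2.2.2.lt_iff_gt, lt_or_ge])
    (by rintro (b | b) <;> simp [h.2.2.2.lt_iff_gt, lt_or_ge])]
  simp only [Fintype.sum_sum_type, Sum.elim_inl, Sum.elim_inr, sum_ite_gt, sum_ite_lt, h1,
    smul_eq_mul]
  rw [Finset.sum_boole, ← numAbove]
  ring

theorem coherentParam_inl {p q : ℕ} (lam : Idx p q → ℝ) (i : Fin p) :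
    coherentParam lam (.inl i) = lam (.inl i) - ((p : ℝ) + q - 1 - 2 * i) / 2 := by
  rw [coherentParam, Pi.sub_apply, rhoG_inl]

theorem coherentParam_inr {p q : ℕ} (lam : Idx p q → ℝ) (j : Fin q) :
    coherentParam lam (.inr j) = lam (.inr j) - ((q : ℝ) - 1 - 2 * j - p) / 2 := by
  rw [coherentParam, Pi.sub_apply, rhoG_inr]

theorem IsHCParam.exists_int_sub {p q : ℕ} {lam : Idx p q → ℝ} (h : IsHCParam lam)
    (a b : Idx p q) : ∃ k : ℤ, lam a - lam b = k := by
  obtain ⟨k, hk⟩ := h.1 a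
  obtain ⟨l, hl⟩ := h.1 b
  exact ⟨k - l, by rw [hk, hl]; push_cast; ring⟩

theorem IsHCParam.add_one_le {p q : ℕ} {lam : Idx p q → ℝ} (h : IsHCParam lam) {a b : Idx p q}
    (hab : lam b < lam a) : lam b + 1 ≤ lam a := by
  obtain ⟨k, hk⟩ := h.exists_int_sub a b
  have : (0 : ℝ) < k := by linarith
  have : (1 : ℝ) ≤ k := by exact_mod_cast (show 0 < k by exact_mod_cast this)
  linarith

theorem sub_le_of_forall_lt {n : ℕ} {f : Fin n → ℝ} (hf : ∀ i j, i < j → f j + 1 ≤ f i)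
    {i j : Fin n} (hij : i ≤ j) : (j : ℝ) - i ≤ f i - f j := by
  obtain ⟨j, hj⟩ := j
  induction j with
  | zero =>
    obtain rfl : i = ⟨0, hj⟩ := le_antisymm hij (Nat.zero_le _)
    simp
  | succ j ih =>
    rcases hij.eq_or_lt with rfl | hlt
    · simp
    · have h1 := ih (by omega) (Nat.lt_succ_iff.mp hlt)
      have h2 := hf ⟨j, by omega⟩ ⟨j + 1, hj⟩ (by simp)
      simp only at h1 ⊢
      push_cast
      linarith

theorem IsHCParam.sub_le_inl {p q : ℕ} {lam : Idx p q → ℝ} (h : IsHCParam lam) {i j : Fin p}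
    (hij : i ≤ j) : (j : ℝ) - i ≤ lam (.inl i) - lam (.inl j) :=
  sub_le_of_forall_lt (f := fun i => lam (.inl i)) (fun _ _ h' => h.add_one_le (h.2.2.1 h')) hij

theorem IsHCParam.sub_le_inr {p q : ℕ} {lam : Idx p q → ℝ} (h : IsHCParam lam) {i j : Fin q}
    (hij : i ≤ j) : (j : ℝ) - i ≤ lam (.inr i) - lam (.inr j) :=
  sub_le_of_forall_lt (f := fun i => lam (.inr i)) (fun _ _ h' => h.add_one_le (h.2.2.2 h')) hij

theorem IsHCParam.coherentParam_dominant {p q : ℕ} {lam : Idx p q → ℝ} (h : IsHCParam lam) :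
    (∀ a, ∃ k : ℤ, coherentParam lam a = k) ∧ (Antitone fun i => coherentParam lam (.inl i)) ∧
      Antitone fun j => coherentParam lam (.inr j) := by
  refine ⟨?_, fun i j hij => ?_, fun i j hij => ?_⟩
  · rintro (i | j)
    · obtain ⟨k, hk⟩ := h.1 (.inl i)
      exact ⟨k + 1 + i, by rw [coherentParam_inl, hk]; push_cast; ring⟩
    · obtain ⟨k, hk⟩ := h.1 (.inr j)
      exact ⟨k + p + 1 + j, by rw [coherentParam_inr, hk]; push_cast; ring⟩
  · have := h.sub_le_inl hij
    simp only [coherentParam_inl]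
    linarith
  · have := h.sub_le_inr hij
    simp only [coherentParam_inr]
    linarith

/-- The `λ`-coordinates drop by at least one per index, which offsets `ρ_c`, while `numBelow`
decreases and `numAbove` increases weakly with the index. -/
theorem IsHCParam.blattner_dominant {p q : ℕ} {lam : Idx p q → ℝ} (h : IsHCParam lam) :
    (∀ a, ∃ k : ℤ, blattner lam a = k) ∧ (Antitone fun i => blattner lam (.inl i)) ∧
      Antitone fun j => blattner lam (.inr j) := by
  refine ⟨?_, fun i j hij => ?_, fun i j hij => ?_⟩
  · rintro (i | j)
    · obtain ⟨k, hk⟩ := h.1 (.inl i)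
      exact ⟨k + 1 + i + numBelow lam i, by rw [blattner_inl h, hk]; push_cast; ring⟩
    · obtain ⟨k, hk⟩ := h.1 (.inr j)
      exact ⟨k + p + 1 + j - numAbove lam j, by rw [blattner_inr h, hk]; push_cast; ring⟩
  · have h1 := h.sub_le_inl hij
    have h2 : (numBelow lam j : ℝ) ≤ numBelow lam i := by
      unfold numBelow
      exact_mod_cast Finset.card_le_card (Finset.monotone_filter_right _ fun k _ hk =>
        lt_of_lt_of_le hk (h.2.2.1.antitone hij))
    simp only [blattner_inl h]
    linarith
  · have h1 := h.sub_le_inr hij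
    have h2 : (numAbove lam i : ℝ) ≤ numAbove lam j := by
      unfold numAbove
      exact_mod_cast Finset.card_le_card (Finset.monotone_filter_right _ fun k _ hk =>
        lt_of_le_of_lt (h.2.2.2.antitone hij) hk)
    simp only [blattner_inr h]
    linarith

/-! ### Signatures of pairs of parameters -/

/-- If `λ'_{p+j} = λ_{p+j} + 1/2` for all `j`, the associated pattern is reducible. -/
theorem reduces_of_inr_eq {m q : ℕ} {s : List Symbol} {lam : Idx (m + 1) q → ℝ}
    {lam' : Idx m q → ℝ} (hs : IsSignature m q s) (hG : IsGGPPattern s) (hlam : IsHCParam lam)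
    (hlam' : IsHCParam lam') (hsig : IsAssociatedSignature lam lam' s)
    (h : ∀ j, lam' (.inr j) = lam (.inr j) + 1 / 2) :
    Relation.ReflTransGen WeakStep s [.plus] := by
  obtain ⟨l, hmem, hp, rfl⟩ := hsig
  set val := Sum.elim lam lam' with hval
  refine reduces_of_isChain _ ?_ ?_ ?_ ?_
  · rw [List.isChain_map, List.isChain_iff_forall_rel_of_append_cons_cons]
    rintro a b l₁ l₂ hl
    -- Symbols adjacent in the list have no coordinate strictly between them.
    have hadj : ∀ c, val a ≤ val c ∨ val c ≤ val b := by
      intro c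
      have hc := hl ▸ hmem c
      rw [hl, List.pairwise_append, List.pairwise_cons, List.pairwise_cons] at hp
      rcases List.mem_append.mp hc with hc | hc
      · exact .inl (hp.2.2 c hc a (by simp)).le
      · rcases List.mem_cons.mp hc with rfl | hc
        · exact .inl le_rfl
        · rcases List.mem_cons.mp hc with rfl | hc
          · exact .inr le_rfl
          · exact .inr (hp.2.1.2.1 c hc).le
    have hba : val b < val a := by
      rw [hl, List.pairwise_append, List.pairwise_cons] at hp
      exact hp.2.1.1 b (by simp)
    refine ⟨?_, fun ha => ?_, fun hb => ?_⟩
    · have := (List.isChain_map symbolOf).mp hG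
      rw [List.isChain_iff_forall_rel_of_append_cons_cons] at this
      exact this hl
    -- The coordinate `λ_{p+j}` lies 1/2 below this `⊖`, so the next symbol lies in that half-open
    -- gap. Another coordinate of `λ'` would be a full unit lower, and one of `λ` must be `λ_{p+j}`
    -- itself.
    · obtain ⟨j, rfl⟩ : ∃ j, a = .inr (.inr j) := by
        rcases a with (a | a) | (a | a) <;> simp [symbolOf] at ha ⊢
      have h1 := h j
      have h2 := hadj (.inl (.inr j))
      simp only [hval, Sum.elim_inr, Sum.elim_inl] at h2 hba
      have h3 := h2.resolve_left (by linarith)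
      rcases b with b | b
      · simp only [Sum.elim_inl] at h3 hba
        have h4 : lam (.inr j) = lam b := by
          by_contra hne
          have := hlam.add_one_le (lt_of_le_of_ne h3 hne)
          linarith
        rw [← hlam.2.1 h4]
        rfl
      · simp only [Sum.elim_inr] at h3 hba
        have := hlam'.add_one_le hba
        linarith
    · obtain ⟨j, rfl⟩ : ∃ j, b = .inl (.inr j) := by
        rcases b with (b | b) | (b | b) <;> simp [symbolOf] at hb ⊢
      have h1 := h j
      have h2 := hadj (.inr (.inr j))
      simp only [hval, Sum.elim_inr, Sum.elim_inl] at h2 hba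
      have h3 := h2.resolve_right (by linarith)
      rcases a with a | a
      · simp only [Sum.elim_inl] at h3 hba
        have := hlam.add_one_le hba
        linarith
      · simp only [Sum.elim_inr] at h3 hba
        have h4 : lam' a = lam' (.inr j) := by
          by_contra hne
          have := hlam'.add_one_le (lt_of_le_of_ne h3 hne)
          linarith
        rw [hlam'.2.1 h4]
        rfl
  · rcases l with _ | ⟨a, l⟩
    · simp
    · intro hb
      obtain ⟨j, rfl⟩ : ∃ j, a = .inl (.inr j) := by
        rcases a with (a | a) | (a | a) <;> simp [symbolOf] at hb ⊢
      have h1 := h j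
      have h2 : val (.inr (.inr j)) ≤ val (.inl (.inr j)) := by
        rcases List.mem_cons.mp (hmem (.inr (.inr j))) with hc | hc
        · simp at hc
        · exact ((List.pairwise_cons.mp hp).1 _ hc).le
      simp only [hval, Sum.elim_inr, Sum.elim_inl] at h2
      linarith
  · rcases List.eq_nil_or_concat l with rfl | ⟨l, a, rfl⟩
    · simp
    · simp only [List.concat_eq_append] at hmem hp ⊢
      intro hb
      obtain ⟨j, rfl⟩ : ∃ j, a = .inr (.inr j) := by
        rcases a with (a | a) | (a | a) <;> simp [symbolOf] at hb ⊢
      have h1 := h j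
      have h2 : val (.inr (.inr j)) ≤ val (.inl (.inr j)) := by
        rcases List.mem_append.mp (hmem (.inl (.inr j))) with hc | hc
        · exact ((List.pairwise_append.mp hp).2.2 _ hc _ (by simp)).le
        · simp at hc
      simp only [hval, Sum.elim_inr, Sum.elim_inl] at h2
      linarith
  · obtain ⟨⟨h1, -⟩, h2, -⟩ := (isSignature_iff _ _ _).mp hs
    rw [h1, h2]

/-- Replacing `p` by `p - 1` raises the `U(q)`-coordinates of `ρ_𝔤` by 1/2, so equal highest weights
give the shift of 1/2. -/
theorem reduces_of_condW {m q : ℕ} {s : List Symbol} (hs : IsSignature m q s)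
    (h : CondW m q s) : Relation.ReflTransGen WeakStep s [.plus] := by
  obtain ⟨lam, lam', hlam, hlam', hsig, hG, hocc⟩ := h
  refine reduces_of_inr_eq hs hG hlam hlam' hsig fun j => ?_
  have := hocc.right_eq j
  rw [coherentParam_inr, coherentParam_inr] at this
  push_cast at this
  linarith

/-! ### Condition (nc) in terms of parameters -/

/-- The sign of a coordinate of `U(p,q)`. -/
def signOf {p q : ℕ} : Idx p q → Sign := Sum.elim (fun _ => .plus) fun _ => .minus

theorem mem_take_iff {α : Type*} {L : List α} {f : α → ℝ}
    (hp : L.Pairwise fun a b => f b < f a) {k : ℕ} {c d : α} (hk : L[k]? = some c)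
    (hd : d ∈ L) : d ∈ L.take k ↔ f c < f d := by
  obtain ⟨hkl, hkc⟩ := List.getElem?_eq_some_iff.mp hk
  have hL : L = L.take k ++ c :: L.drop (k + 1) := by
    rw [← hkc, List.getElem_cons_drop, List.take_append_drop]
  rw [hL, List.pairwise_append, List.pairwise_cons] at hp
  constructor
  · intro h
    exact hp.2.2 d h c (by simp)
  · intro h
    rw [hL] at hd
    rcases List.mem_append.mp hd with hd | hd
    · exact hd
    · rcases List.mem_cons.mp hd with rfl | hd
      · exact absurd h (lt_irrefl _)
      · exact absurd h (hp.2.1.1 d hd).not_gt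

/-- In descending order the coordinates of one factor appear in the order of their indices, so
occurrence numbers are indices. -/
theorem count_take_eq {p q : ℕ} {lam : Idx p q → ℝ} {L : List (Idx p q)} (hmem : ∀ a, a ∈ L)
    (hp : L.Pairwise fun a b => lam b < lam a) {k : ℕ} {c : Idx p q} (hk : L[k]? = some c)
    {n : ℕ} (e : Fin n → Idx p q) (he : Function.Injective e) {σ : Sign}
    (hσ : ∀ d, signOf d = σ ↔ ∃ i, e i = d) (hanti : StrictAnti fun i => lam (e i)) {i : Fin n}
    (hi : e i = c) : ((L.map signOf).take k).count σ = i := by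
  classical
  have hnd : L.Nodup := hp.imp fun {a b} h hab => by rw [hab] at h; exact lt_irrefl _ h
  rw [← List.map_take, List.count_eq_countP, List.countP_map, List.countP_eq_length_filter,
    ← List.toFinset_card_of_nodup ((hnd.sublist (List.take_sublist k L)).filter _)]
  have : ((L.take k).filter ((fun x => x == σ) ∘ signOf)).toFinset = (Finset.Iio i).image e := by
    ext d
    simp only [List.mem_toFinset, List.mem_filter, mem_take_iff hp hk (hmem d), Function.comp_apply,
      beq_iff_eq, hσ, Finset.mem_image, Finset.mem_Iio]
    constructor
    · rintro ⟨h1, i', rfl⟩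
      rw [← hi] at h1
      exact ⟨i', hanti.lt_iff_gt.mp h1, rfl⟩
    · rintro ⟨i', h1, rfl⟩
      rw [← hi]
      exact ⟨hanti h1, i', rfl⟩
  rw [this, Finset.card_image_of_injective _ he, Fin.card_Iio]

theorem mem_ncRoots_iff {p q : ℕ} {lam : Idx p q → ℝ} {L : List (Idx p q)} (hmem : ∀ a, a ∈ L)
    (hp : L.Pairwise fun a b => lam b < lam a) (h1 : StrictAnti fun i => lam (.inl i))
    (h2 : StrictAnti fun j => lam (.inr j)) (i j : ℕ) :
    (i, j) ∈ ncRoots (L.map signOf) ↔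
      ∃ (hi : i < p) (hj : j < q), lam (.inr ⟨j, hj⟩) < lam (.inl ⟨i, hi⟩) := by
  have hplus : ∀ k (i : Fin p), L[k]? = some (.inl i) → ((L.map signOf).take k).count .plus = i :=
    fun k i hk => count_take_eq hmem hp hk Sum.inl Sum.inl_injective
      (by rintro (d | d) <;> simp [signOf]) h1 rfl
  have hminus : ∀ k (j : Fin q), L[k]? = some (.inr j) → ((L.map signOf).take k).count .minus = j :=
    fun k i hk => count_take_eq hmem hp hk Sum.inr Sum.inr_injective
      (by rintro (d | d) <;> simp [signOf]) h2 rfl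
  constructor
  · rintro ⟨k, l, hkl, ⟨hk, rfl⟩, hl, rfl⟩
    rw [List.getElem?_map, Option.map_eq_some_iff] at hk hl
    obtain ⟨a, hk, ha⟩ := hk
    obtain ⟨b, hl, hb⟩ := hl
    obtain ⟨i, rfl⟩ : ∃ i, a = .inl i := by rcases a with a | a <;> simp [signOf] at ha ⊢
    obtain ⟨j, rfl⟩ : ∃ j, b = .inr j := by rcases b with b | b <;> simp [signOf] at hb ⊢
    refine ⟨by rw [hplus k i hk]; exact i.2, by rw [hminus l j hl]; exact j.2, ?_⟩
    simp only [hplus k i hk, hminus l j hl]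
    obtain ⟨hk', hk⟩ := List.getElem?_eq_some_iff.mp hk
    obtain ⟨hl', hl⟩ := List.getElem?_eq_some_iff.mp hl
    have := List.pairwise_iff_getElem.mp hp k l hk' hl' hkl
    rwa [hk, hl] at this
  · rintro ⟨hi, hj, hlt⟩
    obtain ⟨k, hk⟩ := List.mem_iff_getElem?.mp (hmem (.inl ⟨i, hi⟩))
    obtain ⟨l, hl⟩ := List.mem_iff_getElem?.mp (hmem (.inr ⟨j, hj⟩))
    refine ⟨k, l, ?_, ⟨?_, hplus k _ hk⟩, ?_, hminus l _ hl⟩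
    · by_contra hkl
      obtain ⟨hk', hk''⟩ := List.getElem?_eq_some_iff.mp hk
      obtain ⟨hl', hl''⟩ := List.getElem?_eq_some_iff.mp hl
      rcases (not_lt.mp hkl).eq_or_lt with rfl | hlk
      · rw [hk] at hl
        simp at hl
      · have := List.pairwise_iff_getElem.mp hp l k hl' hk' hlk
        rw [hk'', hl''] at this
        exact lt_asymm hlt this
    · rw [List.getElem?_map, hk]; rfl
    · rw [List.getElem?_map, hl]; rfl

theorem deco_map_symbolOf {m q : ℕ} (l : List (Idx (m + 1) q ⊕ Idx m q)) :
    deco (l.map symbolOf) = (l.filterMap Sum.getLeft?).map signOf := by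
  rw [deco, List.filterMap_map, List.map_filterMap]
  congr 1
  funext a
  rcases a with (a | a) | (a | a) <;> rfl

theorem deco'_map_symbolOf {m q : ℕ} (l : List (Idx (m + 1) q ⊕ Idx m q)) :
    deco' (l.map symbolOf) = (l.filterMap Sum.getRight?).map signOf := by
  rw [deco', List.filterMap_map, List.map_filterMap]
  congr 1
  funext a
  rcases a with (a | a) | (a | a) <;> rfl

/-- By (nc) the same roots `e_i - e_{p+j}` are positive on `λ` and on `λ'`; in particular the last
`+`, which has no counterpart in `λ'`, is above no `-`. -/
theorem numAbove_eq_of_condNC {m q : ℕ} {s : List Symbol} {lam : Idx (m + 1) q → ℝ}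
    {lam' : Idx m q → ℝ} (hnc : CondNC s) (hlam : IsHCParam lam)
    (hlam' : IsHCParam lam') (hsig : IsAssociatedSignature lam lam' s) (j : Fin q) :
    numAbove lam j = numAbove lam' j := by
  obtain ⟨l, hmem, hp, rfl⟩ := hsig
  rw [CondNC, deco_map_symbolOf, deco'_map_symbolOf] at hnc
  have hL := mem_ncRoots_iff (lam := lam) (L := l.filterMap Sum.getLeft?)
    (fun a => List.mem_filterMap.mpr ⟨.inl a, hmem _, rfl⟩)
    (List.Pairwise.filterMap _ (fun a b hab c hc d hd => by
      rcases a with a | a <;> rcases b with b | b <;> simp at hc hd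
      rw [hc, hd] at hab; exact hab) hp) hlam.2.2.1 hlam.2.2.2
  have hR := mem_ncRoots_iff (lam := lam') (L := l.filterMap Sum.getRight?)
    (fun a => List.mem_filterMap.mpr ⟨.inr a, hmem _, rfl⟩)
    (List.Pairwise.filterMap _ (fun a b hab c hc d hd => by
      rcases a with a | a <;> rcases b with b | b <;> simp at hc hd
      rw [hc, hd] at hab; exact hab) hp) hlam'.2.2.1 hlam'.2.2.2
  have key : ∀ (i : Fin (m + 1)), lam (.inr j) < lam (.inl i) ↔
      ∃ hi : (i : ℕ) < m, lam' (.inr j) < lam' (.inl ⟨i, hi⟩) := by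
    intro i
    have h1 := (hL i j).symm.trans ((Set.ext_iff.mp hnc (i, j)).trans (hR i j))
    simpa [Nat.lt_succ_iff.mp i.2] using h1
  unfold numAbove
  symm
  refine Finset.card_bij (fun i _ => i.castSucc) ?_ ?_ ?_
  · intro i hi
    rw [Finset.mem_filter] at hi ⊢
    exact ⟨Finset.mem_univ _, (key _).mpr ⟨i.2, hi.2⟩⟩
  · intro i _ i' _ h
    exact Fin.castSucc_injective _ h
  · intro i hi
    rw [Finset.mem_filter, key] at hi
    obtain ⟨_, hi1, hi2⟩ := hi
    exact ⟨⟨i, hi1⟩, by simpa using hi2, rfl⟩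

/-- With equal counts `numAbove`, the Blattner formulas on `U(q)` differ only in `p / 2` against `(p
- 1) / 2`. -/
theorem reduces_of_condNC_of_condMu {m q : ℕ} {s : List Symbol} (hs : IsSignature m q s)
    (hnc : CondNC s) (h : CondMu m q s) : Relation.ReflTransGen WeakStep s [.plus] := by
  obtain ⟨lam, lam', hlam, hlam', hsig, hG, hocc⟩ := h
  refine reduces_of_inr_eq hs hG hlam hlam' hsig fun j => ?_
  have := hocc.right_eq j
  rw [blattner_inr hlam, blattner_inr hlam', numAbove_eq_of_condNC hnc hlam hlam' hsig] at this
  push_cast at this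
  linarith

/-! ### Parameters of a reducible pattern -/

/-- A reducible pattern arises from parameters whose coordinates are grouped into pairs
`λ_i, λ'_i = λ_i - 1/2` and `λ'_{p+j} = λ_{p+j} + 1/2, λ_{p+j}` far apart from each other. -/
theorem exists_params_of_reduces {m q : ℕ} {s : List Symbol} (hs : IsSignature m q s)
    (h : Relation.ReflTransGen WeakStep s [.plus]) :
    ∃ (lam : Idx (m + 1) q → ℝ) (lam' : Idx m q → ℝ),
      IsHCParam lam ∧ IsHCParam lam' ∧ IsAssociatedSignature lam lam' s ∧
      (∀ i, lam' (.inl i) = lam (.inl i.castSucc) - 1 / 2) ∧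
      (∀ j, lam' (.inr j) = lam (.inr j) + 1 / 2) ∧
      ∀ i j, lam' (.inr j) < lam' (.inl i) ↔ lam (.inr j) < lam (.inl i.castSucc) := by
  obtain ⟨L, rfl, hmem, hp⟩ := exists_blocks_of_reduces h m q hs
  have hnd : L.Nodup := hp.imp fun {a b} h hab => by
    subst hab
    rcases a with i | j
    · exact lt_irrefl _ (h.1 i i rfl rfl)
    · exact lt_irrefl _ (h.2 j j rfl rfl)
  -- `pos a` is the place of block `a` in the word.
  choose pos hposlt hpos using fun a => List.mem_iff_getElem.mp (hmem a)
  have hposinj : Function.Injective pos := fun a b hab => by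
    rw [← hpos a, ← hpos b]
    simp only [hab]
  have hlt : ∀ {a b}, pos a < pos b → (∀ i j, a = .inl i → b = .inl j → i < j) ∧
      ∀ i j, a = .inr i → b = .inr j → i < j := by
    intro a b hab
    have := List.pairwise_iff_getElem.mp hp (pos a) (pos b) (hposlt a) (hposlt b) hab
    rwa [hpos, hpos] at this
  have hLpos : L.Pairwise fun a b => pos a < pos b := by
    rw [List.pairwise_iff_getElem]
    intro i j hi hj hij
    rwa [(hnd.getElem_inj_iff).mp (hpos L[i]), (hnd.getElem_inj_iff).mp (hpos L[j])]
  have hposl : StrictMono fun i => pos (.inl i) := by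
    intro i i' hii
    by_contra hn
    have hne : pos (.inl i') ≠ pos (.inl i) := fun he => hii.ne' (Sum.inl_injective (hposinj he))
    exact lt_asymm hii ((hlt (lt_of_le_of_ne (not_lt.mp hn) hne)).1 i' i rfl rfl)
  have hposr : StrictMono fun j => pos (.inr j) := by
    intro i i' hii
    by_contra hn
    have hne : pos (.inr i') ≠ pos (.inr i) := fun he => hii.ne' (Sum.inr_injective (hposinj he))
    exact lt_asymm hii ((hlt (lt_of_le_of_ne (not_lt.mp hn) hne)).2 i' i rfl rfl)
  -- With `p = m + 1` this is `(p + q + 1) / 2`, the class required of `λ`; a shift by 1/2 in either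
  -- direction gives the class required of `λ'`. Block `a` sits within 1/2 of `c - 2 * pos a`, so
  -- blocks never overlap, and the final `+` lies below them all.
  let c : ℝ := ((m : ℝ) + q + 2) / 2
  let lam : Idx (m + 1) q → ℝ := Sum.elim
    (Fin.snoc (α := fun _ => ℝ) (fun i => c - 2 * pos (.inl i)) (c - 2 * L.length))
    fun j => c - 2 * pos (.inr j)
  let lam' : Idx m q → ℝ := Sum.elim (fun i => c - 2 * pos (.inl i) - 1 / 2)
    fun j => c - 2 * pos (.inr j) + 1 / 2
  have e1 : ∀ i : Fin m, lam (.inl i.castSucc) = c - 2 * pos (.inl i) := fun i => by simp [lam]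
  have e2 : lam (.inl (Fin.last m)) = c - 2 * L.length := by simp [lam]
  have e3 : ∀ j, lam (.inr j) = c - 2 * pos (.inr j) := fun _ => rfl
  have e4 : ∀ i, lam' (.inl i) = c - 2 * pos (.inl i) - 1 / 2 := fun _ => rfl
  have e5 : ∀ j, lam' (.inr j) = c - 2 * pos (.inr j) + 1 / 2 := fun _ => rfl
  have hposlt' : ∀ a, (pos a : ℝ) < L.length := fun a => by exact_mod_cast hposlt a
  have hposinj' : ∀ {a b}, (pos a : ℝ) = pos b → a = b := fun h => hposinj (by exact_mod_cast h)
  have hposl' : ∀ {i j}, i < j → (pos (.inl i) : ℝ) < pos (.inl j) := fun h => by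
    exact_mod_cast hposl h
  have hposr' : ∀ {i j}, i < j → (pos (.inr i) : ℝ) < pos (.inr j) := fun h => by
    exact_mod_cast hposr h
  have hgap : ∀ {a b}, pos a < pos b → (pos a : ℝ) + 1 ≤ pos b := fun h => by exact_mod_cast h
  refine ⟨lam, lam', ⟨?_, ?_, ?_, ?_⟩, ⟨?_, ?_, ?_, ?_⟩, ?_, fun i => by rw [e1, e4],
    fun j => by rw [e3, e5], fun i j => ?_⟩
  · rintro (i | j)
    · refine Fin.lastCases ⟨-2 * L.length, ?_⟩ (fun i => ⟨-2 * pos (.inl i), ?_⟩) i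
      · rw [e2]; simp only [c]; push_cast; ring
      · rw [e1]; simp only [c]; push_cast; ring
    · exact ⟨-2 * pos (.inr j), by rw [e3]; simp only [c]; push_cast; ring⟩
  · rintro (i | j) (i' | j') he
    · revert he
      refine Fin.lastCases ?_ (fun i => ?_) i <;> refine Fin.lastCases ?_ (fun i' => ?_) i'
      · intro _; rfl
      · intro he; rw [e2, e1] at he; linarith [hposlt' (.inl i')]
      · intro he; rw [e2, e1] at he; linarith [hposlt' (.inl i)]
      · intro he
        rw [e1, e1] at he
        have := hposinj' (a := .inl i) (b := .inl i') (by linarith)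
        rw [Sum.inl_injective this]
    · exfalso
      revert he
      refine Fin.lastCases ?_ (fun i => ?_) i
      · intro he; rw [e2, e3] at he; linarith [hposlt' (.inr j')]
      · intro he
        rw [e1, e3] at he
        have := hposinj' (a := .inl i) (b := .inr j') (by linarith)
        simp at this
    · exfalso
      revert he
      refine Fin.lastCases ?_ (fun i => ?_) i'
      · intro he; rw [e2, e3] at he; linarith [hposlt' (.inr j)]
      · intro he
        rw [e1, e3] at he
        have := hposinj' (a := .inl i) (b := .inr j) (by linarith)
        simp at this
    · rw [e3, e3] at he
      exact congrArg _ (Sum.inr_injective (hposinj' (a := .inr j) (b := .inr j') (by linarith)))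
  · intro i i'
    refine Fin.lastCases ?_ (fun i => ?_) i <;> refine Fin.lastCases ?_ (fun i' => ?_) i'
    · intro h; exact absurd h (lt_irrefl _)
    · intro h; exact absurd h (Fin.le_last _).not_gt
    · intro _; simp only [e1, e2]; linarith [hposlt' (.inl i)]
    · intro h; simp only [e1]; linarith [hposl' (Fin.castSucc_lt_castSucc_iff.mp h)]
  · intro j j' h; simp only [e3]; linarith [hposr' h]
  · rintro (i | j)
    · exact ⟨-2 * pos (.inl i), by rw [e4]; simp only [c]; push_cast; ring⟩
    · exact ⟨-2 * pos (.inr j) + 1, by rw [e5]; simp only [c]; push_cast; ring⟩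
  · have hne : ∀ i j, lam' (.inl i) ≠ lam' (.inr j) := by
      intro i j he
      rw [e4, e5] at he
      rcases lt_trichotomy (pos (.inl i)) (pos (.inr j)) with h | h | h
      · have := hgap h; linarith
      · rw [h] at he; linarith
      · have := hgap h; linarith
    rintro (i | j) (i' | j') he
    · rw [e4, e4] at he
      exact congrArg _ (Sum.inl_injective (hposinj' (a := .inl i) (b := .inl i') (by linarith)))
    · exact (hne _ _ he).elim
    · exact (hne _ _ he.symm).elim
    · rw [e5, e5] at he
      exact congrArg _ (Sum.inr_injective (hposinj' (a := .inr j) (b := .inr j') (by linarith)))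
  · intro i i' h; simp only [e4]; linarith [hposl' h]
  · intro j j' h; simp only [e5]; linarith [hposr' h]
  · let blk : Fin m ⊕ Fin q → List (Idx (m + 1) q ⊕ Idx m q) := Sum.elim
      (fun i => [.inl (.inl i.castSucc), .inr (.inl i)])
      fun j => [.inr (.inr j), .inl (.inr j)]
    have hblk : ∀ a, ∀ x ∈ blk a, c - 2 * pos a - 1 / 2 ≤ Sum.elim lam lam' x ∧
        Sum.elim lam lam' x ≤ c - 2 * pos a + 1 / 2 := by
      rintro (i | j) x hx <;> simp only [blk, Sum.elim_inl, Sum.elim_inr, List.mem_cons,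
        List.not_mem_nil, or_false] at hx <;> rcases hx with rfl | rfl <;>
        simp only [Sum.elim_inl, Sum.elim_inr, e1, e3, e4, e5] <;> constructor <;> linarith
    refine ⟨L.flatMap blk ++ [.inl (.inl (Fin.last m))], ?_, ?_, ?_⟩
    · rintro ((i | j) | (i | j))
      · refine Fin.lastCases (by simp) (fun i => ?_) i
        exact List.mem_append_left _ (List.mem_flatMap.mpr ⟨.inl i, hmem _, by simp [blk]⟩)
      · exact List.mem_append_left _ (List.mem_flatMap.mpr ⟨.inr j, hmem _, by simp [blk]⟩)
      · exact List.mem_append_left _ (List.mem_flatMap.mpr ⟨.inl i, hmem _, by simp [blk]⟩)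
      · exact List.mem_append_left _ (List.mem_flatMap.mpr ⟨.inr j, hmem _, by simp [blk]⟩)
    · rw [List.pairwise_append, List.pairwise_flatMap]
      refine ⟨⟨?_, ?_⟩, List.pairwise_singleton _ _, ?_⟩
      · rintro (i | j) _
        · simp only [blk, Sum.elim_inl, List.pairwise_cons, List.mem_singleton, forall_eq,
            Sum.elim_inr, e1, e4]
          refine ⟨by linarith, by simp, .nil⟩
        · simp only [blk, Sum.elim_inl, List.pairwise_cons, List.mem_singleton, forall_eq,
            Sum.elim_inr, e3, e5]
          refine ⟨by linarith, by simp, .nil⟩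
      · refine hLpos.imp fun {a b} hab x hx y hy => ?_
        have h1 := (hblk a x hx).1
        have h2 := (hblk b y hy).2
        have h3 := hgap hab
        linarith
      · intro x hx y hy
        obtain ⟨a, -, hx⟩ := List.mem_flatMap.mp hx
        obtain rfl := List.mem_singleton.mp hy
        have h1 := (hblk a x hx).1
        have h2 : (pos a : ℝ) + 1 ≤ L.length := by exact_mod_cast hposlt a
        rw [Sum.elim_inl, e2]
        linarith
    · rw [List.map_append, List.map_flatMap]
      congr 2
      funext a
      rcases a with a | a <;> rfl
  · rw [e1, e3, e4, e5]
    constructor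
    · intro h; linarith
    · intro h
      have h1 : pos (.inl i) < pos (.inr j) := by
        have : (pos (.inl i) : ℝ) < pos (.inr j) := by linarith
        exact_mod_cast this
      have := hgap h1
      linarith

/-- The shifts by `-1/2` and `+1/2` are the changes of `ρ_𝔤` from `U(p,q)` to `U(p-1,q)`, so the
smaller highest weight is the larger one without its last `U(p)` coordinate. -/
theorem condW_of_reduces {m q : ℕ} {s : List Symbol} (hs : IsSignature m q s)
    (hG : IsGGPPattern s) (h : Relation.ReflTransGen WeakStep s [.plus]) : CondW m q s := by
  obtain ⟨lam, lam', hlam, hlam', hsig, h1, h2, -⟩ := exists_params_of_reduces hs h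
  obtain ⟨d1, d2, d3⟩ := hlam.coherentParam_dominant
  refine ⟨lam, lam', hlam, hlam', hsig, hG, occursInRestriction_of_dominant d1 d2 d3 ?_⟩
  rintro (i | j)
  · rw [idxEmb, Sum.map_inl, coherentParam_inl, coherentParam_inl, h1, Fin.val_castSucc]
    push_cast
    ring
  · rw [idxEmb, Sum.map_inr, id, coherentParam_inr, coherentParam_inr, h2]
    push_cast
    ring

/-- The relative order of the two kinds of coordinates is the same for `λ'` as for `λ` without its
last `U(p)` coordinate, and that coordinate is above no `λ_{p+j}`. So the counts agree, and the
shifts by 1/2 absorb the rest of the Blattner formulas. -/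
theorem condMu_of_reduces {m q : ℕ} {s : List Symbol} (hs : IsSignature m q s)
    (hG : IsGGPPattern s) (h : Relation.ReflTransGen WeakStep s [.plus]) : CondMu m q s := by
  obtain ⟨lam, lam', hlam, hlam', hsig, h1, h2, h3⟩ := exists_params_of_reduces hs h
  obtain ⟨d1, d2, d3⟩ := hlam.blattner_dominant
  refine ⟨lam, lam', hlam, hlam', hsig, hG, occursInRestriction_of_dominant d1 d2 d3 ?_⟩
  rintro (i | j)
  · have : numBelow lam' i = numBelow lam i.castSucc := by
      unfold numBelow
      simp only [h3]
    rw [idxEmb, Sum.map_inl, blattner_inl hlam', blattner_inl hlam, h1, this, Fin.val_castSucc]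
    push_cast
    ring
  · rw [idxEmb, Sum.map_inr, id, blattner_inr hlam', blattner_inr hlam, h2,
      numAbove_eq_of_condNC (condDeltaPlus_of_reduces h).condNC hlam hlam' hsig]
    push_cast
    ring

end UnitaryGGP

/-! ### The equivalences and their consequences, through condition (iii) -/

theorem mainTheorem6 (m q : ℕ) (s : List UnitaryGGP.Symbol)
    (hs : UnitaryGGP.IsSignature m q s) (hGGP : UnitaryGGP.IsGGPPattern s) :
    List.TFAE
      [ UnitaryGGP.CondW m q s,
        Relation.ReflTransGen UnitaryGGP.Step s [UnitaryGGP.Symbol.plus],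
        Relation.ReflTransGen UnitaryGGP.WeakStep s [UnitaryGGP.Symbol.plus],
        UnitaryGGP.CondMinusOminusMinus m q s,
        UnitaryGGP.CondMinusOminusMinus m q s ∧ s.getLast? = some UnitaryGGP.Symbol.plus,
        UnitaryGGP.CondNC s ∧ UnitaryGGP.CondMu m q s ] ∧
    (UnitaryGGP.CondW m q s →
      UnitaryGGP.CondMu m q s ∧ UnitaryGGP.CondQ s ∧ UnitaryGGP.CondDeltaPlus s) := by
  open UnitaryGGP in
  refine ⟨?_, fun h => ?_⟩
  · tfae_have 1 → 3 := reduces_of_condW hs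
    tfae_have 3 → 1 := condW_of_reduces hs hGGP
    tfae_have 2 → 3 := reflTransGen_weakStep_of_step
    tfae_have 3 → 2 := reflTransGen_step_of_weakStep
    tfae_have 3 → 5 := fun h => ⟨condMinusOminusMinus_of_reduces h m q hs, getLast?_of_reduces h⟩
    tfae_have 5 → 4 := And.left
    tfae_have 4 → 3 := reduces_of_condMinusOminusMinus s m q hs hGGP
    tfae_have 3 → 6 := fun h => ⟨(condDeltaPlus_of_reduces h).condNC, condMu_of_reduces hs hGGP h⟩
    tfae_have 6 → 3 := fun h => reduces_of_condNC_of_condMu hs h.1 h.2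
    tfae_finish
  · have hr := reduces_of_condW hs h
    exact ⟨condMu_of_reduces hs hGGP hr, (condDeltaPlus_of_reduces hr).condQ,
      condDeltaPlus_of_reduces hr⟩
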